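/- Throughout, rings are commutative and subcategories are full and closed under isomorphism. Let $R$ be a noetherian ring and $I\subsetneq R$ a proper ideal such that $\operatorname{Sing} R\subseteq \mathrm{V}(I)$, where $\operatorname{Sing}R$ is the set of primes $\mathfrak p$ for which $R_{\mathfrak p}$ is not a regular local ring and $\mathrm V(I)$ is the set of primes containing $I$. Notation. $\operatorname{mod}R$ is the category of finitely generated $R$-modules, $\operatorname{D^b}(R)$ its bounded derived category, and $\operatorname{D_{sg}}(R)$ the singularity category, i.e. the Verdier quotient of $\operatorname{D^b}(R)$ by the thick closure of $R$ (the smallest triangulated subcategory containing $R$ and closed under direct summands). $\mu(I)$ is the minimal number of generators of $I$, and $\operatorname{grade}I$ is the supremum of the lengths of $R$-regular sequences in $I$. The ideal $\operatorname{ann}_R\operatorname{D_{sg}}(R)$ is the intersection of the annihilators of the $R$-modules $\operatorname{End}_{\operatorname{D_{sg}}(R)}(X)$ over all objects $X$. For a subcategory $\mathcal X$ of $\operatorname{mod}R$, $\operatorname{filt}\mathcal X$ is the smallest subcategory of $\operatorname{mod}R$ containing $\mathcal X$ and closed under extensions. Subcategories of $\operatorname{mod} R$, and $\operatorname{mod}R/I$,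 are identified with their essential images under the natural functors $\operatorname{mod}R/I\to\operatorname{mod}R\to\operatorname{D^b}(R)\to\operatorname{D_{sg}}(R)$. For a subcategory $\mathcal X$ of a triangulated category $\mathcal T$ with shift $\Sigma$, $\langle\mathcal X\rangle$ consists of the direct summands of finite (possibly empty) direct sums of objects $\Sigma^iX$ with $i\in\mathbb Z$, $X\in\mathcal X$; $\mathcal X\ast\mathcal Y$ consists of the objects $Z$ admitting an exact triangle $X\to Z\to Y\to\Sigma X$ with $X\in\mathcal X$, $Y\in\mathcal Y$; $\mathcal X\diamond\mathcal Y=\langle\langle\mathcal X\rangle\ast\langle\mathcal Y\rangle\rangle$; and $\langle\mathcal X\rangle_0=0$, $\langle\mathcal X\rangle_1=\langle\mathcal X\rangle$, $\langle\mathcal X\rangle_r=\langle\mathcal X\rangle_{r-1}\diamond\langle\mathcal X\rangle$ for $r>1$. Put $\operatorname{radius}_{\mathcal T}\mathcal X=\inf\{n\ge0\mid \mathcal X\subseteq\langle G\rangle_{n+1}\text{ for some }G\in\mathcal T\}\in\mathbb N\cup\{\infty\}$ and $\dim\mathcal T=\operatorname{radius}_{\mathcal T}\mathcal T$. Then $$\operatorname{D_{sg}}(R)=\langle\operatorname{filt}\{R/\mathfrak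 p\mid\mathfrak p\in\mathrm V(I)\}\rangle_{\mu(I)-\operatorname{grade}I+1}.$$ If, moreover, $I\subseteq\operatorname{ann}_R\operatorname{D_{sg}}(R)$, then $$\operatorname{D_{sg}}(R)=\langle\operatorname{mod}R/I\rangle_{\mu(I)-\operatorname{grade}I+1}$$ and $$\dim\operatorname{D_{sg}}(R)\le(\operatorname{radius}_{\operatorname{D_{sg}}(R)}(\operatorname{mod}R/I)+1)(\mu(I)-\operatorname{grade}I+1)-1\le(\dim\operatorname{D^b}(R/I)+1)(\mu(I)-\operatorname{grade}I+1)-1.$$ -/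

import Mathlib

open CategoryTheory Limits Pretriangulated

universe u

noncomputable section

namespace SgCat

section Triangulated

variable {T : Type*} [Category* T] [HasZeroObject T] [HasShift T ℤ] [Preadditive T]
  [∀ n : ℤ, (shiftFunctor T n).Additive] [Pretriangulated T]

/-- `add P`: direct summands of finite (possibly empty) direct sums of objects in `P`. -/
def add (P : ObjectProperty T) : ObjectProperty T := fun X =>
  ∃ (n : ℕ) (f : Fin n → T), (∀ i, P (f i)) ∧ Nonempty (Retract X (⨁ f))

/-- `⟨P⟩`: the additive closure of the objects `X⟦i⟧` with `i ∈ ℤ` and `X` in `P`. -/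
def bracket (P : ObjectProperty T) : ObjectProperty T := add (P.shiftClosure ℤ)

/-- `P ⋄ Q = ⟨⟨P⟩ ∗ ⟨Q⟩⟩`, where `𝒳 ∗ 𝒴` (Mathlib's `extensionProduct`) consists of the objects `Z`
in a distinguished triangle `X ⟶ Z ⟶ Y ⟶ X⟦1⟧` with `X` in `𝒳` and `Y` in `𝒴`. -/
def diamond (P Q : ObjectProperty T) : ObjectProperty T :=
  bracket (ObjectProperty.extensionProduct (bracket P) (bracket Q))

/-- `⟨P⟩_r`: the ball of radius `r` centered at `P`. -/
def ball (P : ObjectProperty T) : ℕ → ObjectProperty T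
  | 0 => IsZero
  | 1 => bracket P
  | r + 2 => diamond (ball P (r + 1)) P

/-- The radius of `P` in `T`: the infimum of the `n ≥ 0` such that `P ⊆ ⟨G⟩_{n+1}` for some
object `G` of `T` (it is `⊤` if there is no such `n`). -/
def radius (P : ObjectProperty T) : ℕ∞ :=
  ⨅ (n : ℕ) (_ : ∃ G : T, P ≤ ball (ObjectProperty.singleton G) (n + 1)), (n : ℕ∞)

variable (T) in
/-- The (Rouquier) dimension of the triangulated category `T`. -/
def dimension : ℕ∞ := radius (⊤ : ObjectProperty T)

end Triangulated

/-- `filt P`: the smallest strictly full subcategory of the abelian category `A` which contains `P`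
and is closed under extensions. -/
def filt {A : Type*} [Category* A] [Abelian A] (P : ObjectProperty A) : ObjectProperty A :=
  sInf {Q | P ≤ Q ∧ Q.IsClosedUnderIsomorphisms ∧ Q.IsClosedUnderExtensions}

section Ring

variable (R : Type u) [CommRing R] [IsNoetherianRing R]

/-- The standard choice of a localization of the category of cochain complexes of finitely
generated `R`-modules with respect to quasi-isomorphisms. -/
instance hasDerivedCategoryFGModuleCat : HasDerivedCategory (FGModuleCat.{u} R) := HasDerivedCategory.standard _

/-- `D^b(R)`: the bounded derived category of finitely generated `R`-modules. -/
abbrev Db := DerivedCategory.Bounded (FGModuleCat.{u} R)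

/-- The functor `mod R ⥤ D^b(R)` which sends a module to the complex concentrated in degree `0`. -/
def toDb : FGModuleCat.{u} R ⥤ Db R :=
  ObjectProperty.lift _ (DerivedCategory.singleFunctor (FGModuleCat.{u} R) 0)
    fun _ => ⟨⟨0, inferInstance⟩, ⟨0, inferInstance⟩⟩

/-- The perfect complexes: the thick closure of `R` in `D^b(R)`, i.e. the smallest triangulated
subcategory of `D^b(R)` which contains `R` and is closed under direct summands. -/
abbrev perfect : ObjectProperty (Db R) :=
  (ObjectProperty.singleton ((toDb R).obj (FGModuleCat.of R R))).triangEnvelope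

/-- `D_sg(R)`: the singularity category of `R`, the Verdier quotient of `D^b(R)` by the perfect
complexes. -/
abbrev Dsg := (perfect R).trW.Localization

/-- The composite of the natural functors `mod R ⥤ D^b(R) ⥤ D_sg(R)`. -/
def toDsg : FGModuleCat.{u} R ⥤ Dsg R := toDb R ⋙ (perfect R).trW.Q


/-- `ann_R D_sg(R)`: the intersection of the annihilators of the `R`-modules `End(X)`, for all
objects `X` of `D_sg(R)`. -/
def annDsg : Ideal R := ⨅ X : Dsg R, Module.annihilator R (X ⟶ X)

variable {R}

/-- The modules `R ⧸ p`, where `p` is a prime ideal containing `I`. -/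
def cyclicPrimes (I : Ideal R) : ObjectProperty (FGModuleCat.{u} R) :=
  ObjectProperty.ofObj fun p : PrimeSpectrum.zeroLocus (I : Set R) =>
    FGModuleCat.of R (R ⧸ p.1.asIdeal)

/-- The natural functor `mod R/I ⥤ mod R`: restriction of scalars along `R → R ⧸ I`. -/
def restrictQuotient (I : Ideal R) : FGModuleCat.{u} (R ⧸ I) ⥤ FGModuleCat.{u} R :=
  ObjectProperty.lift _
    ((ModuleCat.isFG (R ⧸ I)).ι ⋙ ModuleCat.restrictScalars (Ideal.Quotient.mk I)) fun M => by
      let m : Module R M.obj := Module.compHom M.obj (Ideal.Quotient.mk I)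
      have : Module.Finite (R ⧸ I) M.obj := M.property
      have : IsScalarTower R (R ⧸ I) M.obj := IsScalarTower.of_algebraMap_smul fun _ _ => rfl
      change @Module.Finite R M.obj _ _ m
      exact Module.Finite.trans (R ⧸ I) M.obj

/-- `mod R/I` as a subcategory of `D_sg(R)`: the essential image of the composite of the natural
functors `mod R/I ⥤ mod R ⥤ D^b(R) ⥤ D_sg(R)`. -/
def modQuotient (I : Ideal R) : ObjectProperty (Dsg R) := (restrictQuotient I ⋙ toDsg R).essImage

/-- `filt {R ⧸ p ∣ p ∈ V(I)}` as a subcategory of `D_sg(R)`: its essential image under the natural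
functor `mod R ⥤ D_sg(R)`. -/
def filtPrimes (I : Ideal R) : ObjectProperty (Dsg R) := (filt (cyclicPrimes I)).map (toDsg R)

end Ring

section Ideals

variable {R : Type u} [CommRing R]

variable (R) in
/-- `Sing R`: the primes `p` such that the localization of `R` at `p` is not a regular local ring. -/
def singularLocus : Set (PrimeSpectrum R) :=
  {p | ¬ IsRegularLocalRing (Localization.AtPrime p.asIdeal)}

/-- `grade I`: the supremum of the lengths of the `R`-regular sequences contained in `I`.
For `I ≠ R` a weakly regular sequence in `I` is a regular sequence; for `I = R` this gives `∞`. -/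
def grade (I : Ideal R) : ℕ∞ :=
  ⨆ (rs : List R) (_ : (∀ r ∈ rs, r ∈ I) ∧ RingTheory.Sequence.IsWeaklyRegular R rs),
    (rs.length : ℕ∞)

/-- `grade I ≤ μ(I)` for a proper ideal `I` of a noetherian ring. -/
theorem grade_le_spanFinrank [IsNoetherianRing R] (I : Ideal R) (hI : I ≠ ⊤) :
    grade I ≤ (I.spanFinrank : ℕ∞) := by
  refine le_trans (iSup₂_le fun rs h => ?_) (I.height_le_spanFinrank hI)
  rw [Ideal.height_eq_inf_minimalPrimes]
  refine le_iInf₂ fun p hp => ?_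
  have := hp.1.1
  have h1 := (h.2.isRegular_of_isLocalization_of_mem (Localization.AtPrime p) p
    fun r hr => hp.1.2 (h.1 r hr))
  have h2 := ringKrullDim_add_length_eq_ringKrullDim_of_isRegular _ h1
  have h3 : (((rs.length : ℕ∞)) : WithBot ℕ∞) ≤ ringKrullDim (Localization.AtPrime p) := by
    rw [← h2, List.length_map]
    have := Ideal.Quotient.nontrivial_iff.mpr (ne_of_lt <| by simpa using h1.top_ne_smul.symm.lt_top)
    exact le_add_of_nonneg_left ringKrullDim_nonneg_of_nontrivial
  rwa [IsLocalization.AtPrime.ringKrullDim_eq_height p, WithBot.coe_le_coe] at h3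

/-- The natural number `μ(I) - grade I + 1`, where `μ(I)` is the minimal number of generators of
`I`. For a proper ideal `I` of a noetherian ring both terms are finite and the subtraction is not
truncated, see `grade_le_spanFinrank`. -/
def ballRadius (I : Ideal R) : ℕ := I.spanFinrank - (grade I).toNat + 1

end Ideals

end SgCat

end

/-! Let `X` be an object of `D_sg(R)`, and put m = μ(I), g = grade I. If a prime p does not contain
I, then R_p is regular, so modules have free syzygies at p and some s ∉ p annihilates `X`. Hence
some power of each element of I annihilates `X` (`le_radical_annihilator_end`). Let z₁, …, z_m be
suitable powers of generators of I; when I lies in `annDsg R`, the generators themselves do.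

As each zᵢ is zero on `X`, the cone of zᵢ splits in `D_sg(R)`, and `X` is a direct summand of its
Koszul object on the zᵢ (`exists_koszul`). The homology of that object is annihilated by the zᵢ, so
each homology module comes from mod R/I, or is zero or filtered by R/p with p ∈ V(I). It remains to
arrange that at most m - g + 1 of these modules are nonzero.

Represent `X` by a complex in degrees ≥ a. Attaching shifted free modules, which vanish in
`D_sg(R)`, pushes it into degrees ≤ a - g (`exists_dsgOf_iso_isLE`). Homology may then appear below
a, but because I has grade g a depth condition survives: Hom(N[-j], -) = 0 for j < a and every N
annihilated by the zᵢ. The Koszul construction lowers this bound by m, and for a complex whose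
homology is annihilated by the zᵢ the condition says that homology vanishes below a - m
(`isGE_of_homVanish`). The Koszul object thus lives in [a - m, a - g], and truncation builds it in m
- g + 1 steps.

The dimension bounds are formal: radii of nested balls multiply, and triangulated functors preserve
balls. -/

open CategoryTheory Limits Pretriangulated

noncomputable section

namespace SgCat

/-! ### Balls, radius and dimension in a triangulated category -/

section Balls

variable {T : Type*} [Category* T] [HasZeroObject T] [HasShift T ℤ] [Preadditive T]
  [∀ n : ℤ, (shiftFunctor T n).Additive] [Pretriangulated T]

/-- `Q` is closed under direct summands, shifts and finite direct sums. -/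
structure IsAddShiftClosed (Q : ObjectProperty T) : Prop where
  retract : ∀ {X Y : T}, Retract X Y → Q Y → Q X
  shift : ∀ {X : T} (n : ℤ), Q X → Q (X⟦n⟧)
  sum : ∀ {n : ℕ} (f : Fin n → T), (∀ i, Q (f i)) → Q (⨁ f)

theorem IsAddShiftClosed.of_iso {Q : ObjectProperty T} (hQ : IsAddShiftClosed Q) {X Y : T}
    (e : X ≅ Y) (hX : Q X) : Q Y :=
  hQ.retract (Retract.ofIso e.symm) hX

theorem IsAddShiftClosed.of_isZero {Q : ObjectProperty T} (hQ : IsAddShiftClosed Q) {X : T}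
    (hX : IsZero X) : Q X :=
  hQ.retract (hX.retract _) (hQ.sum (n := 0) (fun i => i.elim0) fun i => i.elim0)

theorem add_of_retract_biproduct (P : ObjectProperty T) {J : Type} [Finite J] (f : J → T)
    (hf : ∀ j, P (f j)) {X : T} (r : Retract X (⨁ f)) : add P X := by
  obtain ⟨n, ⟨e⟩⟩ := Finite.exists_equiv_fin J
  exact ⟨n, f ∘ e.symm, fun i => hf _, ⟨r.trans (Retract.ofIso
    (biproduct.whiskerEquiv e fun j => eqToIso (by simp)))⟩⟩

theorem isAddShiftClosed_add (P : ObjectProperty T)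
    (hP : ∀ {X : T} (n : ℤ), P X → P (X⟦n⟧)) : IsAddShiftClosed (add P) where
  retract := by
    rintro X Y r ⟨n, f, hf, ⟨s⟩⟩
    exact ⟨n, f, hf, ⟨r.trans s⟩⟩
  shift := by
    rintro X m ⟨n, f, hf, ⟨s⟩⟩
    exact ⟨n, fun i => (f i)⟦m⟧, fun i => hP m (hf i),
      ⟨(s.map (shiftFunctor T m)).trans (Retract.ofIso ((shiftFunctor T m).mapBiproduct f))⟩⟩
  sum := by
    intro n X hX
    choose k f hf r using hX
    refine add_of_retract_biproduct P (J := Σ i : Fin n, Fin (k i)) (fun p => f p.1 p.2)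
      (fun p => hf _ _) (Retract.trans (Y := ⨁ fun i => ⨁ f i) ?_
        (Retract.ofIso (biproductBiproductIso _ _)))
    exact ⟨biproduct.map fun i => (r i).some.i, biproduct.map fun i => (r i).some.r, by
      ext; simp⟩

theorem isAddShiftClosed_bracket (P : ObjectProperty T) : IsAddShiftClosed (bracket P) :=
  isAddShiftClosed_add _ fun n h => (P.shiftClosure ℤ).le_shift n _ h

theorem le_bracket (P : ObjectProperty T) : P ≤ bracket P := fun X hX =>
  add_of_retract_biproduct _ (fun _ : Unit => X) (fun _ => ObjectProperty.le_shiftClosure P _ hX)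
    ⟨biproduct.ι (fun _ : Unit => X) (), biproduct.π (fun _ : Unit => X) (), by simp⟩

theorem bracket_le {P Q : ObjectProperty T} (hQ : IsAddShiftClosed Q) (h : P ≤ Q) :
    bracket P ≤ Q := by
  rintro X ⟨n, f, hf, ⟨r⟩⟩
  refine hQ.retract r (hQ.sum f fun i => ?_)
  obtain ⟨Y, a, e, hY⟩ := hf i
  exact hQ.of_iso e.symm (hQ.shift a (h _ hY))

theorem bracket_eq_self {Q : ObjectProperty T} (hQ : IsAddShiftClosed Q) : bracket Q = Q :=
  le_antisymm (bracket_le hQ le_rfl) (le_bracket Q)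

theorem isAddShiftClosed_isZero : IsAddShiftClosed (IsZero : ObjectProperty T) where
  retract r hY := by
    rw [IsZero.iff_id_eq_zero, ← r.retract, hY.eq_of_tgt r.i 0, zero_comp]
  shift n hX := (shiftFunctor T n).map_isZero hX
  sum f hf := by
    rw [IsZero.iff_id_eq_zero]
    exact biproduct.hom_ext _ _ fun i => (hf i).eq_of_tgt _ _

/-- Products of distinguished triangles are distinguished, so extensions are already stable under
shifts and finite sums. The outer bracket in `diamond` therefore only adds direct summands. -/
theorem isAddShiftClosed_retractClosure_extensionProduct {P Q : ObjectProperty T}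
    (hP : IsAddShiftClosed P) (hQ : IsAddShiftClosed Q) :
    IsAddShiftClosed (ObjectProperty.extensionProduct P Q).retractClosure where
  retract r hY := ObjectProperty.prop_of_retract _ r hY
  shift n hX := by
    have : P.IsStableUnderShift ℤ := ⟨fun a => ⟨fun X hX => hP.shift a hX⟩⟩
    have : Q.IsStableUnderShift ℤ := ⟨fun a => ⟨fun X hX => hQ.shift a hX⟩⟩
    exact ObjectProperty.le_shift _ n _ hX
  sum {n} X hX := by
    choose X' hX' r using hX
    choose A B f g h hT hA hB using hX'
    refine ⟨∏ᶜ X', ?_, ⟨(⟨biproduct.map fun i => (r i).some.i,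
      biproduct.map fun i => (r i).some.r, by ext; simp⟩ : Retract (⨁ X) (⨁ X')).trans
        (Retract.ofIso (biproduct.isoProduct X'))⟩⟩
    exact ⟨_, _, _, _, _, productTriangle_distinguished (fun i => Triangle.mk (f i) (g i) (h i)) hT,
      hP.of_iso (biproduct.isoProduct A) (hP.sum A hA),
      hQ.of_iso (biproduct.isoProduct B) (hQ.sum B hB)⟩

theorem bracket_extensionProduct {P Q : ObjectProperty T}
    (hP : IsAddShiftClosed P) (hQ : IsAddShiftClosed Q) :
    bracket (ObjectProperty.extensionProduct P Q) =
      (ObjectProperty.extensionProduct P Q).retractClosure := by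
  refine le_antisymm (bracket_le (isAddShiftClosed_retractClosure_extensionProduct hP hQ)
    (ObjectProperty.le_retractClosure _)) ?_
  rintro X ⟨Y, hY, ⟨r⟩⟩
  exact (isAddShiftClosed_bracket _).retract r (le_bracket _ _ hY)

theorem isAddShiftClosed_ball (P : ObjectProperty T) : ∀ r, IsAddShiftClosed (ball P r)
  | 0 => isAddShiftClosed_isZero
  | 1 => isAddShiftClosed_bracket P
  | _ + 2 => isAddShiftClosed_bracket _

theorem extensionProduct_isZero_left (P : ObjectProperty T) :
    ObjectProperty.extensionProduct IsZero P = P.isoClosure := by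
  ext X
  constructor
  · rintro ⟨Y, Z, f, g, h, hT, hY, hZ⟩
    have : IsIso g := (Triangle.isZero₁_iff_isIso₂ _ hT).1 hY
    exact ⟨Z, hZ, ⟨asIso g⟩⟩
  · intro hX
    rw [← ObjectProperty.extensionProduct_isoClosure_right]
    exact ObjectProperty.le_extensionProduct_right (Q := P.isoClosure) _ _ hX

theorem extensionProduct_isZero_right (P : ObjectProperty T) :
    ObjectProperty.extensionProduct P IsZero = P.isoClosure := by
  ext X
  constructor
  · rintro ⟨Y, Z, f, g, h, hT, hY, hZ⟩
    have : IsIso f := (Triangle.isZero₃_iff_isIso₁ _ hT).1 hZ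
    exact ⟨Y, hY, ⟨(asIso f).symm⟩⟩
  · intro hX
    rw [← ObjectProperty.extensionProduct_isoClosure_left]
    exact ObjectProperty.le_extensionProduct_left (P := P.isoClosure) _ _ hX

theorem IsAddShiftClosed.isoClosure_eq {Q : ObjectProperty T} (hQ : IsAddShiftClosed Q) :
    Q.isoClosure = Q :=
  le_antisymm (fun _ ⟨_, hY, ⟨e⟩⟩ => hQ.of_iso e.symm hY) Q.le_isoClosure

theorem IsAddShiftClosed.retractClosure_eq {Q : ObjectProperty T} (hQ : IsAddShiftClosed Q) :
    Q.retractClosure = Q :=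
  le_antisymm (fun _ ⟨_, hY, ⟨r⟩⟩ => hQ.retract r hY) Q.le_retractClosure

theorem ball_succ (P : ObjectProperty T) (r : ℕ) :
    ball P (r + 1) = (ObjectProperty.extensionProduct (ball P r) (bracket P)).retractClosure := by
  have hP := isAddShiftClosed_bracket P
  cases r with
  | zero =>
    rw [ball, ball, extensionProduct_isZero_left, hP.isoClosure_eq, hP.retractClosure_eq]
  | succ r =>
    rw [ball, diamond, bracket_eq_self (isAddShiftClosed_ball P (r + 1)),
      bracket_extensionProduct (isAddShiftClosed_ball P (r + 1)) hP]

/-- Associativity of `extensionProduct`, which rests on the octahedral axiom, regroups the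
extensions; intermediate retract closures can be absorbed into the outermost one. -/
theorem ball_add [IsTriangulated T] (P : ObjectProperty T) (a b : ℕ) :
    ball P (a + b) = (ObjectProperty.extensionProduct (ball P a) (ball P b)).retractClosure := by
  induction b with
  | zero =>
    rw [add_zero, ball, extensionProduct_isZero_right, (isAddShiftClosed_ball P a).isoClosure_eq,
      (isAddShiftClosed_ball P a).retractClosure_eq]
  | succ b ih =>
    have h1 := (isAddShiftClosed_bracket P).retractClosure_eq
    have h2 := (isAddShiftClosed_ball P a).retractClosure_eq
    rw [← add_assoc, ball_succ, ih, ball_succ P b]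
    conv_lhs => rw [← h1,
      ObjectProperty.retractClosure_extensionProduct_retractClosure_retractClosure,
      ObjectProperty.extensionProduct_assoc]
    conv_rhs => rw [← h2,
      ObjectProperty.retractClosure_extensionProduct_retractClosure_retractClosure]

theorem ball_mono_of_le_ball [IsTriangulated T] {P Q : ObjectProperty T} {a : ℕ}
    (h : P ≤ ball Q a) (b : ℕ) : ball P b ≤ ball Q (a * b) := by
  induction b with
  | zero => exact le_rfl
  | succ b ih =>
    rw [ball_succ, mul_add, mul_one, ball_add]
    exact ObjectProperty.monotone_retractClosure
      ((ObjectProperty.monotone_extensionProduct_left _ ih).trans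
        (ObjectProperty.monotone_extensionProduct_right _
          (bracket_le (isAddShiftClosed_ball Q a) h)))

theorem ball_succ_of_distinguished {P : ObjectProperty T} {r : ℕ} (S : Triangle T)
    (hS : S ∈ distTriang T) (h₁ : ball P r S.obj₁) (h₃ : bracket P S.obj₃) :
    ball P (r + 1) S.obj₂ := by
  rw [ball_succ]
  exact ObjectProperty.le_retractClosure _ _ ⟨_, _, _, _, _, hS, h₁, h₃⟩

variable {T' : Type*} [Category* T'] [HasZeroObject T'] [HasShift T' ℤ] [Preadditive T']
  [∀ n : ℤ, (shiftFunctor T' n).Additive] [Pretriangulated T']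

theorem IsAddShiftClosed.inverseImage {Q : ObjectProperty T'} (hQ : IsAddShiftClosed Q)
    (F : T ⥤ T') [F.CommShift ℤ] [F.Additive] : IsAddShiftClosed (Q.inverseImage F) where
  retract r hY := hQ.retract (r.map F) hY
  shift n hX := hQ.of_iso ((F.commShiftIso n).app _).symm (hQ.shift n hX)
  sum f hf := hQ.of_iso (F.mapBiproduct f).symm (hQ.sum _ hf)

theorem ball_le_inverseImage (F : T ⥤ T') [F.CommShift ℤ] [F.IsTriangulated]
    {P : ObjectProperty T} {Q : ObjectProperty T'} (h : P ≤ Q.inverseImage F) (r : ℕ) :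
    ball P r ≤ (ball Q r).inverseImage F := by
  induction r with
  | zero => exact fun X hX => F.map_isZero hX
  | succ r ih =>
    rw [ball_succ]
    rintro X ⟨Y, ⟨A, B, f, g, k, hT, hA, hB⟩, ⟨s⟩⟩
    refine (isAddShiftClosed_ball Q (r + 1)).retract (s.map F) ?_
    exact ball_succ_of_distinguished _ (F.map_distinguished _ hT) (ih _ hA)
      (bracket_le ((isAddShiftClosed_bracket Q).inverseImage F)
        (fun Z hZ => le_bracket Q _ (h Z hZ)) _ hB)

theorem radius_le_iff (P : ObjectProperty T) (n : ℕ) : radius P ≤ n ↔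
    ∃ m ≤ n, ∃ G : T, P ≤ ball (ObjectProperty.singleton G) (m + 1) := by
  rw [radius]
  constructor
  · intro h
    by_contra! hc
    have : ((n + 1 : ℕ) : ℕ∞) ≤ n := le_trans (le_iInf₂ fun m ⟨G, hG⟩ => by
      by_contra hlt
      obtain ⟨X, hX, hX'⟩ := hc m (Nat.lt_succ_iff.1 (Nat.cast_lt.1 (not_le.1 hlt))) G
      exact hX' (hG X hX)) h
    exact absurd (Nat.cast_le.1 this) (by omega)
  · rintro ⟨m, hm, hG⟩
    exact (iInf₂_le m hG).trans (Nat.cast_le.2 hm)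

theorem radius_eq_top_or (P : ObjectProperty T) : radius P = ⊤ ∨
    ∃ (n : ℕ) (G : T), radius P = n ∧ P ≤ ball (ObjectProperty.singleton G) (n + 1) := by
  by_cases h : radius P = ⊤
  · exact Or.inl h
  · obtain ⟨n, hn⟩ := ENat.ne_top_iff_exists.1 h
    obtain ⟨m, hm, G, hG⟩ := (radius_le_iff P n).1 hn.symm.le
    have : m = n := le_antisymm hm (by
      have : radius P ≤ m := (radius_le_iff P m).2 ⟨m, le_rfl, G, hG⟩
      rw [← hn] at this
      exact Nat.cast_le.1 this)
    exact Or.inr ⟨n, G, hn.symm, this ▸ hG⟩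

/-- If the balls of radius `m` around `P` exhaust `T`, then `dim T ≤ (radius P + 1) m - 1`. -/
theorem dimension_le_of_ball_eq_top [IsTriangulated T] {P : ObjectProperty T} {m : ℕ} (hm : 0 < m)
    (h : ball P m = ⊤) : dimension T ≤ (radius P + 1) * m - 1 := by
  rcases radius_eq_top_or P with h' | ⟨n, G, h', hG⟩
  -- For infinite radius the bound is `⊤`; here `0 < m` excludes the product `⊤ * 0 = 0`.
  · rw [h', top_add, ENat.top_mul (by simpa using hm.ne')]
    exact le_top
  · have h1 := ball_mono_of_le_ball hG m
    rw [h] at h1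
    obtain ⟨k, hk⟩ : ∃ k, (n + 1) * m = k + 1 :=
      Nat.exists_eq_succ_of_ne_zero (by positivity)
    have h2 : (radius P + 1) * m - 1 = (k : ℕ∞) := by
      rw [h']
      norm_cast
      rw [hk]
      simp
    rw [h2, dimension, radius_le_iff]
    exact ⟨k, le_rfl, G, hk ▸ h1⟩

theorem radius_le_dimension (F : T ⥤ T') [F.CommShift ℤ] [F.IsTriangulated]
    (P : ObjectProperty T') (hP : ∀ Y, P Y → ∃ X, Nonempty (F.obj X ≅ Y)) :
    radius P ≤ dimension T := by
  rcases radius_eq_top_or (⊤ : ObjectProperty T) with h | ⟨n, G, h, hG⟩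
  · rw [dimension, h]
    exact le_top
  · rw [dimension, h, radius_le_iff]
    refine ⟨n, le_rfl, F.obj G, fun Y hY => ?_⟩
    obtain ⟨X, ⟨e⟩⟩ := hP Y hY
    refine (isAddShiftClosed_ball _ _).of_iso e (ball_le_inverseImage F ?_ _ X (hG X trivial))
    rintro _ ⟨_⟩
    exact (ObjectProperty.singleton_iff _ _).2 rfl

end Balls

/-! ### Regular local rings have free syzygies -/

section RegularLocal

open IsLocalRing

/-- For a regular local ring `A` of dimension `d + 1` and `x ∈ 𝔪 \ 𝔪 ^ 2`, the ring `A ⧸ (x)` is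
regular local of dimension `d`. -/
theorem isRegularLocalRing_quotient {A : Type*} [CommRing A] [IsRegularLocalRing A] {d : ℕ}
    (hd : ringKrullDim A = (d + 1 : ℕ)) {x : A} (hx : x ∈ maximalIdeal A)
    (hx2 : x ∉ maximalIdeal A ^ 2) :
    IsRegularLocalRing (A ⧸ Ideal.span {x}) ∧ ringKrullDim (A ⧸ Ideal.span {x}) = d := by
  have hx' : Ideal.span {x} ≤ maximalIdeal A := by simpa [Ideal.span_le] using hx
  have hne : Ideal.span {x} ≠ ⊤ := ne_top_of_le_ne_top (maximalIdeal.isMaximal A).ne_top hx'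
  have : Nontrivial (A ⧸ Ideal.span {x}) := Ideal.Quotient.nontrivial_iff.2 hne
  have : IsLocalRing (A ⧸ Ideal.span {x}) :=
    .of_surjective' (Ideal.Quotient.mk _) Ideal.Quotient.mk_surjective
  set V := CotangentSpace A
  have hV : Module.finrank (ResidueField A) V = d + 1 := by
    have := (IsRegularLocalRing.iff_finrank_cotangentSpace A).1 inferInstance
    rw [hd] at this
    exact_mod_cast this
  let v : V := (maximalIdeal A).toCotangent ⟨x, hx⟩
  have hv : v ≠ 0 := fun h => hx2 ((Ideal.toCotangent_eq_zero _ _).1 h)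
  have hli : LinearIndepOn (ResidueField A) id {v} := LinearIndepOn.singleton hv
  let b := Module.Basis.extend hli
  have hfin : Set.Finite (hli.extend (Set.subset_univ {v})) :=
    (Module.Finite.finite_basis b)
  have hcard : (hli.extend (Set.subset_univ {v})).ncard = d + 1 := by
    rw [← hV, Module.finrank_eq_nat_card_basis b]
    rfl
  set B := hli.extend (Set.subset_univ {v})
  have hvB : v ∈ B := hli.subset_extend _ rfl
  -- Lifting a basis of the cotangent space that contains the class of `x` gives d + 1 generators of
  -- the maximal ideal, one of them `x`; the other d generate the maximal ideal of the quotient.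
  choose g hg using (maximalIdeal A).toCotangent_surjective
  let S : Set (maximalIdeal A) := insert ⟨x, hx⟩ (g '' (B \ {v}))
  have hS : Submodule.span A S = ⊤ := by
    rw [← CotangentSpace.span_image_eq_top_iff]
    have : (maximalIdeal A).toCotangent '' S = B := by
      rw [Set.image_insert_eq, ← Set.image_comp, show (maximalIdeal A).toCotangent ∘ g = id from
        funext hg, Set.image_id, Set.insert_sdiff_singleton, Set.insert_eq_of_mem hvB]
    rw [this]
    have hb := (Module.Basis.extend hli).span_eq
    rwa [Module.Basis.range_extend hli] at hb
  have hmA : Ideal.span ((↑) '' S) = maximalIdeal A := by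
    have := congrArg (Submodule.map (maximalIdeal A).subtype) hS
    rw [Submodule.map_span, Submodule.map_top, Submodule.range_subtype] at this
    exact this
  let φ := Ideal.Quotient.mk (Ideal.span {x})
  have hmB : Ideal.span ((fun y : maximalIdeal A => φ y) '' (g '' (B \ {v}))) =
      maximalIdeal (A ⧸ Ideal.span {x}) := by
    have h1 : (maximalIdeal A).map φ = maximalIdeal (A ⧸ Ideal.span {x}) :=
      IsLocalRing.map_maximalIdeal_of_surjective φ Ideal.Quotient.mk_surjective
    have h2 := congrArg (Ideal.map φ) hmA
    rw [h1, Ideal.map_span, Set.image_insert_eq, Set.image_insert_eq, ← Set.image_comp,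
      Ideal.span_insert] at h2
    have : φ x = 0 := Ideal.Quotient.eq_zero_iff_mem.2 (Ideal.mem_span_singleton_self x)
    simp only [this, Ideal.span_singleton_zero, bot_sup_eq] at h2
    exact h2
  have hdim : (d : WithBot ℕ∞) ≤ ringKrullDim (A ⧸ Ideal.span {x}) := by
    have h1 := ringKrullDim_le_ringKrullDim_quotient_add_card ({x} : Finset A) (by
      simpa [IsLocalRing.ringJacobson_eq_maximalIdeal] using hx)
    rw [hd, Finset.coe_singleton, Finset.card_singleton] at h1
    push_cast at h1
    exact ENat.WithBot.add_le_add_one_right_iff.1 h1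
  have hrank : (maximalIdeal (A ⧸ Ideal.span {x})).spanFinrank ≤ d := by
    rw [← hmB]
    have hf : (B \ {v}).Finite := hfin.subset Set.sdiff_subset
    refine (Submodule.spanFinrank_span_le_ncard_of_finite ((hf.image _).image _)).trans ?_
    refine (Set.ncard_image_le (hf.image _)).trans ((Set.ncard_image_le hf).trans ?_)
    rw [Set.ncard_sdiff_singleton_of_mem hvB, hcard]
    simp
  have hreg : IsRegularLocalRing (A ⧸ Ideal.span {x}) :=
    .of_spanFinrank_maximalIdeal_le _ (le_trans (by exact_mod_cast hrank) hdim)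
  refine ⟨hreg, le_antisymm ?_ hdim⟩
  rw [← hreg.spanFinrank_maximalIdeal]
  exact_mod_cast hrank

/-- Prime avoidance, which tolerates the non-prime ideal 𝔪². Otherwise 𝔪 ⊆ 𝔪², so 𝔪 = 0 by Nakayama,
or 𝔪 is a minimal prime; both force dimension 0. -/
theorem exists_mem_maximalIdeal_notMem_sq {A : Type*} [CommRing A] [IsNoetherianRing A]
    [IsLocalRing A] {d : ℕ} (hd : ringKrullDim A = (d + 1 : ℕ)) :
    ∃ x ∈ maximalIdeal A, x ∉ maximalIdeal A ^ 2 ∧ ∀ p ∈ minimalPrimes A, x ∉ p := by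
  by_contra! hcon
  have hmin : (minimalPrimes A).Finite := minimalPrimes.finite_of_isNoetherianRing A
  have hcov : (maximalIdeal A : Set A) ⊆
      ⋃ i ∈ insert (maximalIdeal A ^ 2) (minimalPrimes A), (i : Set A) := by
    intro x hx
    by_cases h2 : x ∈ maximalIdeal A ^ 2
    · exact Set.mem_biUnion (Set.mem_insert _ _) h2
    · obtain ⟨p, hp, hxp⟩ := hcon x hx h2
      exact Set.mem_biUnion (Set.mem_insert_of_mem _ hp) hxp
  obtain ⟨i, hi, hle⟩ := (Ideal.subset_union_prime_finite (hmin.insert _)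
    (f := fun i : Ideal A => i) (maximalIdeal A ^ 2) (maximalIdeal A ^ 2) (by
      rintro i (rfl | hi) h _
      · exact absurd rfl h
      · exact hi.1.1)).1 hcov
  have hdim : ∀ h : ringKrullDim A ≤ 0, False := fun h => by
    rw [hd] at h
    exact absurd (by exact_mod_cast h : d + 1 ≤ 0) (by omega)
  have hheight := IsLocalRing.maximalIdeal_height_eq_ringKrullDim (R := A)
  rcases hi with rfl | hi
  · have hbot : maximalIdeal A = ⊥ := Submodule.eq_bot_of_le_smul_of_le_jacobson_bot
      (maximalIdeal A) _ (IsNoetherian.noetherian _) (by rwa [smul_eq_mul, ← pow_two])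
      (IsLocalRing.maximalIdeal_le_jacobson _)
    refine hdim ?_
    rw [← hheight, hbot]
    simp
  · have h1 : maximalIdeal A ∈ minimalPrimes A := by
      have := hi.1.1
      rwa [← (maximalIdeal.isMaximal A).eq_of_le this.ne_top hle] at hi
    refine hdim ?_
    rw [← hheight]
    have := Ideal.height_eq_zero_iff.2 h1
    simp [this]

theorem isDomain_of_isRegularLocalRing (d : ℕ) : ∀ (A : Type u) [CommRing A]
    [IsRegularLocalRing A], ringKrullDim A = d → IsDomain A := by
  induction d with
  | zero =>
    intro A _ _ hd
    have h := IsRegularLocalRing.spanFinrank_maximalIdeal (R := A)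
    rw [hd] at h
    have : maximalIdeal A = ⊥ := (Submodule.spanFinrank_eq_zero_iff_eq_bot
      (IsNoetherian.noetherian _)).1 (by exact_mod_cast h)
    exact (isField_iff_maximalIdeal_eq.2 this).isDomain
  | succ d ih =>
    intro A _ _ hd
    obtain ⟨x, hx, hx2, hxp⟩ := exists_mem_maximalIdeal_notMem_sq hd
    obtain ⟨hreg, hdim⟩ := isRegularLocalRing_quotient hd hx hx2
    have := ih _ hdim
    have hprime : (Ideal.span {x}).IsPrime := (Ideal.Quotient.isDomain_iff_prime _).1 this
    obtain ⟨p, hp, hle⟩ := Ideal.exists_minimalPrimes_le (bot_le : ⊥ ≤ Ideal.span {x})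
    have hpp := hp.1.1
    -- A minimal prime `p` inside the prime ideal (x) does not contain `x`, so every element of `p`
    -- is `x` times an element of `p`, and Nakayama applies.
    have hbot : p = ⊥ := by
      refine Submodule.eq_bot_of_le_smul_of_le_jacobson_bot (maximalIdeal A) p
        (IsNoetherian.noetherian _) (fun y hy => ?_) (IsLocalRing.maximalIdeal_le_jacobson _)
      obtain ⟨z, rfl⟩ := Ideal.mem_span_singleton'.1 (hle hy)
      rw [mul_comm]
      exact Submodule.smul_mem_smul hx ((hpp.mem_or_mem hy).resolve_right (hxp p hp))
    rw [hbot] at hpp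
    exact IsDomain.of_bot_isPrime A

/-- The `n`-th syzygies of `M` (with respect to surjections from finite free modules) are free. -/
def HasFreeSyzygy (A : Type u) [CommRing A] :
    ℕ → (M : Type u) → [AddCommGroup M] → [Module A M] → Prop
  | 0, M, _, _ => Module.Free A M
  | n + 1, M, _, _ => ∀ (r : ℕ) (f : (Fin r → A) →ₗ[A] M), Function.Surjective f →
      HasFreeSyzygy A n (LinearMap.ker f)

theorem HasFreeSyzygy.of_linearEquiv {A : Type u} [CommRing A] (n : ℕ) {M N : Type u}
    [AddCommGroup M] [Module A M] [AddCommGroup N] [Module A N] (e : M ≃ₗ[A] N)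
    (h : HasFreeSyzygy A n M) : HasFreeSyzygy A n N := by
  cases n with
  | zero =>
    have : Module.Free A M := h
    exact Module.Free.of_equiv e
  | succ n =>
    intro r f hf
    have := h r (e.symm.toLinearMap ∘ₗ f) (e.symm.surjective.comp hf)
    rwa [LinearEquiv.ker_comp] at this

section Descent

variable {A : Type u} [CommRing A] [IsNoetherianRing A] [IsLocalRing A]
  {B : Type u} [CommRing B] {φ : A →+* B} [RingHomSurjective φ] {x : A}

/-- Lifts of a basis of N/xN generate `N` by Nakayama. Since `N` has no x-torsion, the module K of
relations satisfies K = xK, hence K = 0. -/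
theorem free_of_free_quotient (hx : x ∈ maximalIdeal A)
    (hφ : ∀ a, φ a = 0 → ∃ b, a = x * b) {N N' : Type u} [AddCommGroup N] [Module A N]
    [Module.Finite A N] [AddCommGroup N'] [Module B N'] (π : N →ₛₗ[φ] N')
    (hπ : Function.Surjective π) (hker : ∀ n, π n = 0 ↔ ∃ n', n = x • n')
    (htf : ∀ n : N, x • n = 0 → n = 0) (h : Module.Free B N') : Module.Free A N := by
  have : Module.Finite B N' := .of_surjective π hπ
  let b := Module.Free.chooseBasis B N'
  choose v hv using fun i => hπ (b i)
  let f : (Module.Free.ChooseBasisIndex B N' → A) →ₗ[A] N := Fintype.linearCombination A v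
  have hf : ∀ a, π (f a) = ∑ i, φ (a i) • b i := fun a => by
    simp [f, Fintype.linearCombination_apply, hv]
  have hsurj : Function.Surjective f := by
    rw [← LinearMap.range_eq_top, ← top_le_iff]
    refine Submodule.le_of_le_smul_of_le_jacobson_bot (I := maximalIdeal A) Module.Finite.fg_top
      (IsLocalRing.maximalIdeal_le_jacobson _) fun n _ => ?_
    choose a ha using fun i => RingHomSurjective.is_surjective (σ := φ) (b.repr (π n) i)
    obtain ⟨n', hn'⟩ := (hker (n - f a)).1 (by
      rw [map_sub, hf]
      simp [ha, b.sum_repr])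
    rw [← sub_add_cancel n (f a), hn', add_comm]
    exact Submodule.add_mem_sup ⟨a, rfl⟩ (Submodule.smul_mem_smul hx trivial)
  have hinj : LinearMap.ker f = ⊥ := by
    refine Submodule.eq_bot_of_le_smul_of_le_jacobson_bot (maximalIdeal A) _
      (IsNoetherian.noetherian _) (fun a ha => ?_) (IsLocalRing.maximalIdeal_le_jacobson _)
    have h1 : ∑ i, φ (a i) • b i = 0 := by rw [← hf, LinearMap.mem_ker.1 ha, map_zero]
    have h2 := Fintype.linearIndependent_iff.1 b.linearIndependent _ h1
    choose c hc using fun i => hφ _ (h2 i)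
    have hac : a = x • c := funext hc
    rw [hac]
    refine Submodule.smul_mem_smul hx (htf _ ?_)
    rw [← map_smul, ← hac]
    exact ha
  exact .of_equiv (LinearEquiv.ofBijective f ⟨LinearMap.ker_eq_bot.1 hinj, hsurj⟩)

/-- When `N` has no x-torsion, reducing a presentation modulo `x` keeps it exact, so syzygies
commute with reduction. The semilinear map `π` presents `N'` as N/xN, which avoids base change along
the induction. -/
theorem HasFreeSyzygy.of_quotient (hx : x ∈ maximalIdeal A) (hxA : ∀ a, x * a = 0 → a = 0)
    (hφ : ∀ a, φ a = 0 ↔ ∃ b, a = x * b) (n : ℕ) :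
    ∀ {N N' : Type u} [AddCommGroup N] [Module A N] [Module.Finite A N] [AddCommGroup N']
      [Module B N'] (π : N →ₛₗ[φ] N'), Function.Surjective π →
      (∀ n, π n = 0 ↔ ∃ n', n = x • n') → (∀ n : N, x • n = 0 → n = 0) →
      HasFreeSyzygy B n N' → HasFreeSyzygy A n N := by
  induction n with
  | zero =>
    intro N N' _ _ _ _ _ π hπ hker htf h
    exact free_of_free_quotient hx (fun a => (hφ a).1) π hπ hker htf h
  | succ n ih =>
    intro N N' _ _ _ _ _ π hπ hker htf h r f hf
    let g : (Fin r → B) →ₗ[B] N' := Fintype.linearCombination B fun i => π (f (Pi.single i 1))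
    have hgf : ∀ a : Fin r → A, g (fun i => φ (a i)) = π (f a) := fun a => by
      conv_rhs => rw [← (Pi.basisFun A (Fin r)).sum_repr a]
      simp [g, Fintype.linearCombination_apply]
    have hlift : ∀ b : Fin r → B, ∃ a : Fin r → A, (fun i => φ (a i)) = b := fun b => by
      choose a ha using fun i => RingHomSurjective.is_surjective (σ := φ) (b i)
      exact ⟨a, funext ha⟩
    have hg : Function.Surjective g := fun y => by
      obtain ⟨n, rfl⟩ := hπ y
      obtain ⟨a, rfl⟩ := hf n
      exact ⟨_, hgf a⟩
    let ρ : LinearMap.ker f →ₛₗ[φ] LinearMap.ker g :=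
      { toFun := fun a => ⟨fun i => φ (a.1 i), by
          rw [LinearMap.mem_ker, hgf, LinearMap.mem_ker.1 a.2, map_zero]⟩
        map_add' := fun a b => by ext i; simp
        map_smul' := fun c a => by ext i; simp }
    refine ih ρ ?_ ?_ ?_ (h r g hg)
    · rintro ⟨b, hb⟩
      obtain ⟨a, rfl⟩ := hlift b
      rw [LinearMap.mem_ker, hgf, hker] at hb
      obtain ⟨n', hn'⟩ := hb
      obtain ⟨c, rfl⟩ := hf n'
      refine ⟨⟨a - x • c, by rw [LinearMap.mem_ker, map_sub, hn', map_smul, sub_self]⟩, ?_⟩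
      ext i
      have : φ x = 0 := (hφ x).2 ⟨1, by simp⟩
      simp [ρ, this]
    · rintro ⟨a, ha⟩
      constructor
      · intro h0
        have h1 : ∀ i, φ (a i) = 0 := fun i => congrFun (congrArg Subtype.val h0) i
        choose c hc using fun i => (hφ _).1 (h1 i)
        have hac : a = x • c := funext hc
        refine ⟨⟨c, htf _ ?_⟩, Subtype.ext hac⟩
        rw [← map_smul, ← hac]
        exact ha
      · rintro ⟨c, hc⟩
        ext i
        exact (hφ _).2 ⟨c.1 i, congrFun (congrArg Subtype.val hc) i⟩
    · rintro ⟨a, ha⟩ h0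
      ext i
      exact hxA _ (congrFun (congrArg Subtype.val h0) i)

end Descent

/-- Finitely generated modules over a regular local ring of dimension `d` have free `d`-th
syzygies. -/
theorem hasFreeSyzygy_of_isRegularLocalRing (d : ℕ) : ∀ (A : Type u) [CommRing A]
    [IsRegularLocalRing A], ringKrullDim A = d → ∀ (M : Type u) [AddCommGroup M] [Module A M],
      HasFreeSyzygy A d M := by
  induction d with
  | zero =>
    intro A _ _ hd M _ _
    have h := IsRegularLocalRing.spanFinrank_maximalIdeal (R := A)
    rw [hd] at h
    have : maximalIdeal A = ⊥ := (Submodule.spanFinrank_eq_zero_iff_eq_bot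
      (IsNoetherian.noetherian _)).1 (by exact_mod_cast h)
    let := (isField_iff_maximalIdeal_eq.2 this).toField
    exact Module.Free.of_divisionRing A M
  | succ d ih =>
    intro A _ _ hd M _ _ r f hf
    obtain ⟨x, hx, hx2, hxp⟩ := exists_mem_maximalIdeal_notMem_sq hd
    obtain ⟨hreg, hdim⟩ := isRegularLocalRing_quotient hd hx hx2
    have := isDomain_of_isRegularLocalRing _ A hd
    have hx0 : x ≠ 0 := by
      rintro rfl
      exact hx2 (zero_mem _)
    have hxA : ∀ a, x * a = 0 → a = 0 := fun a h => (mul_eq_zero.1 h).resolve_left hx0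
    let I := Ideal.span {x}
    let N := LinearMap.ker f
    let π : N →ₛₗ[Ideal.Quotient.mk I] (N ⧸ I • (⊤ : Submodule A N)) :=
      { toFun := Submodule.Quotient.mk
        map_add' := fun _ _ => rfl
        map_smul' := fun _ _ => rfl }
    have : RingHomSurjective (Ideal.Quotient.mk I) := ⟨Ideal.Quotient.mk_surjective⟩
    -- `M` may have x-torsion, but its first syzygy lies in a free module over a domain and has
    -- none. This accounts for the extra syzygy when the dimension grows by one.
    refine HasFreeSyzygy.of_quotient (φ := Ideal.Quotient.mk I) hx hxA (fun a => ?_) d π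
      (Submodule.Quotient.mk_surjective _) (fun n => ?_) (fun n hn => ?_) (ih (A ⧸ I) hdim _)
    · rw [Ideal.Quotient.eq_zero_iff_mem, Ideal.mem_span_singleton]
      rfl
    · refine (Submodule.Quotient.mk_eq_zero _).trans ?_
      rw [Submodule.ideal_span_singleton_smul, Submodule.mem_smul_pointwise_iff_exists]
      exact ⟨fun ⟨m, _, h⟩ => ⟨m, h.symm⟩, fun ⟨m, h⟩ => ⟨m, trivial, h.symm⟩⟩
    · ext i
      exact hxA _ (congrFun (congrArg Subtype.val hn) i)

end RegularLocal

/-! ### Syzygies and localization at a prime -/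

section Localization

variable {R : Type u} [CommRing R] (p : Ideal R) [p.IsPrime]

theorem HasFreeSyzygy.localizedModule_ker {M : Type u} [AddCommGroup M] [Module R M] {n r : ℕ}
    (h : HasFreeSyzygy (Localization.AtPrime p) (n + 1) (LocalizedModule p.primeCompl M))
    (f : (Fin r → R) →ₗ[R] M) (hf : Function.Surjective f) :
    HasFreeSyzygy (Localization.AtPrime p) n
      (LocalizedModule p.primeCompl (LinearMap.ker f)) := by
  let A := Localization.AtPrime p
  let S := p.primeCompl
  let ι : (Fin r → R) →ₗ[R] (Fin r → A) := .pi fun i => Algebra.linearMap R A ∘ₗ .proj i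
  have hι : IsLocalizedModule S ι := IsLocalizedModule.pi S _
  let mk := LocalizedModule.mkLinearMap S M
  let g : (Fin r → A) →ₗ[A] LocalizedModule S M := IsLocalizedModule.mapExtendScalars S ι mk A f
  have hg : Function.Surjective g := IsLocalizedModule.map_surjective S ι mk f hf
  refine HasFreeSyzygy.of_linearEquiv n ?_ (h r g hg)
  have hk := LinearMap.toKerLocalized_isLocalizedModule A S ι mk f
  let e := IsLocalizedModule.linearEquiv S (LinearMap.toKerIsLocalized S ι mk f)
    (LocalizedModule.mkLinearMap S (LinearMap.ker f))
  let e' : LinearMap.ker g ≃ₗ[R] LinearMap.ker (IsLocalizedModule.map S ι mk f) :=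
    { toFun := fun x => ⟨x.1, x.2⟩
      invFun := fun x => ⟨x.1, x.2⟩
      map_add' := fun _ _ => rfl
      map_smul' := fun _ _ => rfl
      left_inv := fun _ => rfl
      right_inv := fun _ => rfl }
  exact (e'.trans e).extendScalarsOfIsLocalization S A

/-- If `M` is locally free at `p`, then the multiplication on `M` by some `s ∉ p` factors through a
finite free module. -/
theorem exists_notMem_comp_eq_smul [IsNoetherianRing R] {M : Type u} [AddCommGroup M] [Module R M]
    [Module.Finite R M]
    (h : Module.Free (Localization.AtPrime p) (LocalizedModule p.primeCompl M)) :
    ∃ s ∉ p, ∃ (r : ℕ) (g : M →ₗ[R] (Fin r → R)) (f : (Fin r → R) →ₗ[R] M),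
      f ∘ₗ g = s • LinearMap.id := by
  let A := Localization.AtPrime p
  let S := p.primeCompl
  obtain ⟨r, f, hf⟩ := Module.Finite.exists_fin' R M
  let ι : (Fin r → R) →ₗ[R] (Fin r → A) := .pi fun i => Algebra.linearMap R A ∘ₗ .proj i
  have hι : IsLocalizedModule S ι := IsLocalizedModule.pi S _
  let mk := LocalizedModule.mkLinearMap S M
  let fp : (Fin r → A) →ₗ[A] LocalizedModule S M := IsLocalizedModule.mapExtendScalars S ι mk A f
  have hfp : Function.Surjective fp := IsLocalizedModule.map_surjective S ι mk f hf
  -- The section `σ` exists only after localization. Clearing denominators yields `g` over `R` with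
  -- f ∘ g = s locally, and a further factor `t` makes the identity hold on `M`.
  obtain ⟨σ, hσ⟩ := Module.projective_lifting_property fp LinearMap.id hfp
  have := Module.finitePresentation_of_finite R M
  obtain ⟨g, s, hg⟩ := Module.FinitePresentation.exists_lift_of_isLocalizedModule S ι
    (σ.restrictScalars R ∘ₗ mk)
  have hcomp : mk ∘ₗ (f ∘ₗ g) = mk ∘ₗ ((s : R) • LinearMap.id) := by
    ext m
    have h1 : ∀ a, mk (f a) = fp (ι a) := fun a => (IsLocalizedModule.map_apply S ι mk f a).symm
    have h2 : ι (g m) = (s : R) • σ (mk m) := LinearMap.congr_fun hg m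
    have h3 : fp (σ (mk m)) = mk m := LinearMap.congr_fun hσ _
    simp only [LinearMap.comp_apply, LinearMap.smul_apply, LinearMap.id_apply, map_smul]
    rw [h1, h2, LinearMap.map_smul_of_tower, h3]
  obtain ⟨t, ht⟩ := Module.Finite.exists_smul_of_comp_eq_of_isLocalizedModule S mk _ _ hcomp
  refine ⟨t * s, (t * s).2, r, (t : R) • g, f, ?_⟩
  rw [LinearMap.comp_smul, mul_smul]
  exact ht

end Localization

/-! ### Filtrations with subquotients R/p -/

section Filtrations

variable {R : Type u} [CommRing R] [IsNoetherianRing R] {I : Ideal R}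

theorem shortExact_of_linearMap {N₁ N₂ N₃ : FGModuleCat.{u} R} (f : N₁ ⟶ N₂) (g : N₂ ⟶ N₃)
    (hf : Function.Injective f.hom.hom) (hg : Function.Surjective g.hom.hom)
    (h : Function.Exact f.hom.hom g.hom.hom) :
    ∃ w, (ShortComplex.mk f g w).ShortExact := by
  have w : f ≫ g = 0 := by
    ext x
    exact h.apply_apply_eq_zero x
  refine ⟨w, ?_⟩
  let F := forget₂ (FGModuleCat.{u} R) (ModuleCat.{u} R)
  have hS := ModuleCat.shortComplex_shortExact ((ShortComplex.mk f g w).map F) h hf hg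
  have hm : Mono (F.map f) := hS.mono_f
  have he : Epi (F.map g) := hS.epi_g
  exact { exact := (ShortComplex.exact_map_iff_of_faithful _ F).1 hS.exact
          mono_f := F.mono_of_mono_map hm
          epi_g := F.epi_of_epi_map he }

section Filt

variable {A : Type*} [Category* A] [Abelian A] (P : ObjectProperty A)

theorem filt_iff (X : A) : filt P X ↔ ∀ Q : ObjectProperty A, P ≤ Q →
    Q.IsClosedUnderIsomorphisms → Q.IsClosedUnderExtensions → Q X := by
  simp only [filt, sInf_apply, iInf_Prop_eq]
  exact ⟨fun h Q h₁ h₂ h₃ => h ⟨Q, h₁, h₂, h₃⟩, fun h ⟨Q, h₁, h₂, h₃⟩ => h Q h₁ h₂ h₃⟩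

theorem le_filt : P ≤ filt P := fun X hX => (filt_iff P X).2 fun _ h _ _ => h X hX

instance : (filt P).IsClosedUnderIsomorphisms where
  of_iso e h := (filt_iff P _).2 fun Q h₁ h₂ h₃ => Q.prop_of_iso e ((filt_iff P _).1 h Q h₁ h₂ h₃)

instance : (filt P).IsClosedUnderExtensions where
  prop_X₂_of_shortExact hS hX₁ hX₃ := (filt_iff P _).2 fun Q h₁ h₂ h₃ =>
    Q.prop_X₂_of_shortExact hS ((filt_iff P _).1 hX₁ Q h₁ h₂ h₃) ((filt_iff P _).1 hX₃ Q h₁ h₂ h₃)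

end Filt

/-- A nonzero finitely generated module with support in `V(I)` has a filtration with
subquotients of the form `R ⧸ p` with `p ∈ V(I)`. -/
theorem filt_cyclicPrimes_of_smul_eq_zero (M : Type u) [AddCommGroup M] [Module R M]
    [Module.Finite R M] (hM : ∀ x ∈ I, ∃ k : ℕ, ∀ m : M, x ^ k • m = 0) :
    Subsingleton M ∨ filt (cyclicPrimes I) (FGModuleCat.of R M) := by
  induction ‹Module.Finite R M› using
    IsNoetherianRing.induction_on_isQuotientEquivQuotientPrime R with
  | subsingleton N => exact Or.inl inferInstance
  | quotient N p e =>
    refine Or.inr ?_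
    have hp : p ∈ PrimeSpectrum.zeroLocus (I : Set R) := fun x hx => by
      obtain ⟨k, hk⟩ := hM x hx
      refine p.2.mem_of_pow_mem k ?_
      have := congrArg e (hk (e.symm 1))
      rw [map_smul, e.apply_symm_apply, map_zero] at this
      rw [← Ideal.Quotient.eq_zero_iff_mem, ← this, Algebra.smul_def, mul_one]
      rfl
    have h0 : cyclicPrimes I (FGModuleCat.of R (R ⧸ p.asIdeal)) :=
      ObjectProperty.ofObj_apply (fun q : PrimeSpectrum.zeroLocus (I : Set R) =>
        FGModuleCat.of R (R ⧸ q.1.asIdeal)) ⟨p, hp⟩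
    let e' : FGModuleCat.of R (R ⧸ p.asIdeal) ≅ FGModuleCat.of R N := e.symm.toFGModuleCatIso
    exact (filt (cyclicPrimes I)).prop_of_iso e' (le_filt (cyclicPrimes I) _ h0)
  | exact N₁ N₂ N₃ f g hf hg hfg h₁ h₃ =>
    obtain ⟨w, hS⟩ := shortExact_of_linearMap (N₁ := .of R N₁) (N₂ := .of R N₂) (N₃ := .of R N₃)
      ⟨ModuleCat.ofHom f⟩ ⟨ModuleCat.ofHom g⟩ hf hg hfg
    have h₁' := h₁ fun x hx => (hM x hx).imp fun k hk m => hf (by rw [map_smul, hk, map_zero])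
    have h₃' := h₃ fun x hx => (hM x hx).imp fun k hk m => by
      obtain ⟨m, rfl⟩ := hg m
      rw [← map_smul, hk, map_zero]
    -- The zero module is not in `filt`, so when an outer term vanishes the closure under extensions
    -- is replaced by an isomorphism between the other two terms.
    rcases h₁' with h₁' | h₁'
    · have hg' : Function.Injective g := by
        rw [injective_iff_map_eq_zero]
        intro a ha
        obtain ⟨b, rfl⟩ := (hfg a).1 ha
        rw [Subsingleton.elim b 0, map_zero]
      let e := LinearEquiv.ofBijective g ⟨hg', hg⟩
      rcases h₃' with h₃' | h₃'
      · exact Or.inl e.injective.subsingleton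
      · exact Or.inr ((filt (cyclicPrimes I)).prop_of_iso e.symm.toFGModuleCatIso h₃')
    · rcases h₃' with h₃' | h₃'
      · have hf' : Function.Surjective f := fun a => (hfg a).1 (Subsingleton.elim _ _)
        let e := LinearEquiv.ofBijective f ⟨hf, hf'⟩
        exact Or.inr ((filt (cyclicPrimes I)).prop_of_iso e.toFGModuleCatIso h₁')
      · exact Or.inr ((filt (cyclicPrimes I)).prop_X₂_of_shortExact hS h₁' h₃')

end Filtrations

/-- Every `z ∈ S` annihilates the object `X` of the `R`-linear category `C`. -/
def IsKilled {R : Type*} [CommRing R] (S : Set R) {C : Type*} [Category* C] [Preadditive C]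
    [Linear R C] (X : C) : Prop :=
  ∀ z ∈ S, z • 𝟙 X = 0

/-! ### Objects annihilated by a set of scalars -/

section Killed

variable {R : Type*} [CommRing R] {S : Set R} {C : Type*} [Category* C] [Preadditive C]
    [Linear R C] {X Y : C}

theorem IsKilled.smul_eq_zero_left (h : IsKilled S X) {z : R} (hz : z ∈ S) (f : X ⟶ Y) :
    z • f = 0 := by
  rw [← Category.id_comp f, ← Linear.smul_comp, h z hz, zero_comp]

theorem IsKilled.smul_eq_zero_right (h : IsKilled S Y) {z : R} (hz : z ∈ S) (f : X ⟶ Y) :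
    z • f = 0 := by
  rw [← Category.comp_id f, ← Linear.comp_smul, h z hz, comp_zero]

theorem IsKilled.of_mono (h : IsKilled S Y) (f : X ⟶ Y) [Mono f] : IsKilled S X := fun z hz => by
  rw [← cancel_mono f, Linear.smul_comp, Category.id_comp, h.smul_eq_zero_right hz, zero_comp]

theorem IsKilled.of_epi (h : IsKilled S X) (f : X ⟶ Y) [Epi f] : IsKilled S Y := fun z hz => by
  rw [← cancel_epi f, Linear.comp_smul, Category.comp_id, h.smul_eq_zero_left hz, comp_zero]

theorem IsKilled.retract (h : IsKilled S Y) (r : Retract X Y) : IsKilled S X := fun z hz => by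
  rw [← r.retract, ← Linear.smul_comp, h.smul_eq_zero_right hz, zero_comp]

end Killed

/-! ### Truncation triangles and homology -/

section Derived

open DerivedCategory TStructure HomologySequence

variable {C : Type*} [Category* C] [Abelian C] [HasDerivedCategory C]

theorem triangle_mk_distinguished_of_iso₃ {T : Type*} [Category* T] [HasZeroObject T]
    [HasShift T ℤ] [Preadditive T] [∀ n : ℤ, (shiftFunctor T n).Additive] [Pretriangulated T]
    {X Y Z Z' : T} {f : X ⟶ Y} {g : Y ⟶ Z} {h : Z ⟶ X⟦(1 : ℤ)⟧}
    (hT : Triangle.mk f g h ∈ distTriang T) (e : Z ≅ Z') :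
    Triangle.mk f (g ≫ e.hom) (e.inv ≫ h) ∈ distTriang T := by
  refine isomorphic_distinguished _ hT _
    (Triangle.isoMk _ _ (Iso.refl _) (Iso.refl _) e.symm ?_ ?_ ?_)
  · exact (Category.comp_id f).trans (Category.id_comp f).symm
  · change (g ≫ e.hom) ≫ e.inv = 𝟙 _ ≫ g
    simp
  · change (e.inv ≫ h) ≫ (𝟙 X)⟦(1 : ℤ)⟧' = e.inv ≫ h
    simp

theorem mono_homologyMap {X Y Z : DerivedCategory C} {f : X ⟶ Y} {g : Y ⟶ Z} {h : Z ⟶ X⟦(1 : ℤ)⟧}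
    (hT : Triangle.mk f g h ∈ distTriang _) (i : ℤ)
    (hZ : IsZero ((homologyFunctor C (i - 1)).obj Z)) : Mono ((homologyFunctor C i).map f) :=
  (mono_homologyMap_mor₁_iff _ hT (i - 1) i).2 (hZ.eq_of_src _ _)

theorem epi_homologyMap {X Y Z : DerivedCategory C} {f : X ⟶ Y} {g : Y ⟶ Z} {h : Z ⟶ X⟦(1 : ℤ)⟧}
    (hT : Triangle.mk f g h ∈ distTriang _) (i : ℤ)
    (hX : IsZero ((homologyFunctor C (i + 1)).obj X)) : Epi ((homologyFunctor C i).map g) :=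
  (epi_homologyMap_mor₂_iff _ hT i (i + 1)).2 (hX.eq_of_tgt _ _)

theorem isZero_homology₁ {X Y Z : DerivedCategory C} {f : X ⟶ Y} {g : Y ⟶ Z} {h : Z ⟶ X⟦(1 : ℤ)⟧}
    (hT : Triangle.mk f g h ∈ distTriang _) (i : ℤ)
    (hZ : IsZero ((homologyFunctor C (i - 1)).obj Z))
    (hY : IsZero ((homologyFunctor C i).obj Y)) : IsZero ((homologyFunctor C i).obj X) :=
  (exact₁ _ hT (i - 1) i).isZero_of_both_isZero hZ hY

theorem isZero_homology₃ {X Y Z : DerivedCategory C} {f : X ⟶ Y} {g : Y ⟶ Z} {h : Z ⟶ X⟦(1 : ℤ)⟧}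
    (hT : Triangle.mk f g h ∈ distTriang _) (i : ℤ)
    (hY : IsZero ((homologyFunctor C i).obj Y))
    (hX : IsZero ((homologyFunctor C (i + 1)).obj X)) : IsZero ((homologyFunctor C i).obj Z) :=
  (exact₃ _ hT i (i + 1)).isZero_of_both_isZero hY hX

/-- Splits off the top homology. The mono and epi clauses serve to pass annihilation of the homology
of `X` on to `X'` and `N`. -/
theorem exists_truncation_triangle (X : DerivedCategory C) (a b : ℤ) [X.IsGE a] [X.IsLE b]
    (hab : a ≤ b) :
    ∃ (X' : DerivedCategory C) (N : C) (f : X' ⟶ X) (g : X ⟶ (singleFunctor C b).obj N)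
      (h : (singleFunctor C b).obj N ⟶ X'⟦(1 : ℤ)⟧),
      Triangle.mk f g h ∈ distTriang _ ∧ X'.IsGE a ∧ X'.IsLE (b - 1) ∧
      (∀ i, Mono ((homologyFunctor C i).map f)) ∧
      ∃ e : (homologyFunctor C b).obj X ⟶ N, Epi e := by
  obtain ⟨A, B, hA, hB, f, g, h, hT⟩ := t.exists_triangle X (b - 1) b (by omega)
  have hA : A.IsLE (b - 1) := ⟨hA⟩
  have hB : B.IsGE b := ⟨hB⟩
  have hB' : B.IsLE b := by
    rw [isLE_iff]
    exact fun i hi => isZero_homology₃ hT i (isZero_of_isLE _ b i hi)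
      (isZero_of_isLE A (b - 1) (i + 1) (by omega))
  have hA' : A.IsGE a := by
    rw [isGE_iff]
    exact fun i hi => isZero_homology₁ hT i
      (isZero_of_isGE B b (i - 1) (by omega)) (isZero_of_isGE _ a i hi)
  obtain ⟨N, ⟨e⟩⟩ := exists_iso_singleFunctor_obj_of_isGE_of_isLE B b
  refine ⟨A, N, f, g ≫ e.hom, e.inv ≫ h, triangle_mk_distinguished_of_iso₃ hT e, hA', hA, ?_, ?_⟩
  · intro i
    by_cases hi : i ≤ b
    · exact mono_homologyMap hT i (isZero_of_isGE B b (i - 1) (by omega))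
    · have := isZero_of_isLE A (b - 1) i (by omega)
      exact ⟨fun f g _ => this.eq_of_tgt _ _⟩
  · have := epi_homologyMap hT b (isZero_of_isLE A (b - 1) (b + 1) (by omega))
    let e' := (homologyFunctor C b).mapIso e ≪≫ (singleFunctorCompHomologyFunctorIso C b).app N
    exact ⟨(homologyFunctor C b).map g ≫ e'.hom, inferInstance⟩

end Derived

/-! ### A depth condition on complexes -/

section HomVanishing

open DerivedCategory TStructure HomologySequence

variable {R : Type*} [CommRing R] {S : Set R} {C : Type*} [Category* C] [Abelian C] [Linear R C]
  [HasDerivedCategory C]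

/-- The homology objects of `Y` are annihilated by `S`. -/
def HomologyKilled (S : Set R) (Y : DerivedCategory C) : Prop :=
  ∀ i, IsKilled S ((homologyFunctor C i).obj Y)

/-- All morphisms `N[-j] ⟶ Y` with `j < d` vanish, when the object `N` of `C` is annihilated
by `S`. -/
def HomVanish (S : Set R) (Y : DerivedCategory C) (d : ℤ) : Prop :=
  ∀ (N : C), IsKilled S N → ∀ j < d, ∀ f : (singleFunctor C j).obj N ⟶ Y, f = 0

theorem HomVanish.of_isGE (Y : DerivedCategory C) (d : ℤ) [Y.IsGE d] : HomVanish S Y d :=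
  fun _ _ j hj f => t.zero f j d hj

theorem HomVanish.of_le {Y : DerivedCategory C} {d d' : ℤ} (h : HomVanish S Y d) (hd : d' ≤ d) :
    HomVanish S Y d' :=
  fun N hN j hj f => h N hN j (hj.trans_le hd) f

theorem HomVanish.of_iso {Y Y' : DerivedCategory C} {d : ℤ} (h : HomVanish S Y d) (e : Y ≅ Y') :
    HomVanish S Y' d := fun N hN j hj f => by
  rw [← cancel_mono e.inv, h N hN j hj (f ≫ e.inv), zero_comp]

theorem HomVanish.shift {Y : DerivedCategory C} {d : ℤ} (h : HomVanish S Y d) (n d' : ℤ)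
    (hd : n + d' = d) : HomVanish S (Y⟦n⟧) d' := fun N hN j hj f => by
  let e := ((singleFunctors C).shiftIso n j (n + j) rfl).app N
  obtain ⟨g, hg⟩ := (shiftFunctor (DerivedCategory C) n).map_surjective (e.hom ≫ f)
  have h0 := h N hN (n + j) (by omega) g
  rw [← cancel_epi e.hom, ← hg, h0, Functor.map_zero, comp_zero]

theorem HomVanish.obj₃ {T : Triangle (DerivedCategory C)} (hT : T ∈ distTriang _) {d : ℤ}
    (h₁ : HomVanish S T.obj₁ (d + 1)) (h₂ : HomVanish S T.obj₂ d) : HomVanish S T.obj₃ d :=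
  fun N hN j hj f => by
    obtain ⟨g, hg⟩ := Triangle.coyoneda_exact₃ T hT f
      (h₁.shift 1 d (add_comm _ _) N hN j hj _)
    rw [hg, h₂ N hN j hj g, zero_comp]

/-- If N is the homology of `Y` in its lowest possible degree c < d, truncation gives N[-c] ⟶ Y
inducing an isomorphism on that homology. N is annihilated by `S`, so this map is zero and N = 0;
the lower bound moves up step by step. -/
theorem isGE_of_homVanish (Y : DerivedCategory C) (c d : ℤ) [Y.IsGE c] (hY : HomologyKilled S Y)
    (h : HomVanish S Y d) : Y.IsGE d := by
  suffices ∀ n : ℕ, Y.IsGE (d - n) → Y.IsGE d from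
    this (d - c).toNat (t.isGE_of_ge Y _ c (by omega))
  intro n
  induction n with
  | zero => simp
  | succ n ih =>
    intro hn
    refine ih ?_
    obtain ⟨c, hc⟩ : ∃ c, c = d - (n + 1 : ℕ) := ⟨_, rfl⟩
    rw [← hc] at hn
    obtain ⟨A, B, hA, hB, f, g, k, hT⟩ := t.exists_triangle Y c (c + 1) rfl
    have hA : A.IsLE c := ⟨hA⟩
    have hB : B.IsGE (c + 1) := ⟨hB⟩
    have hA' : A.IsGE c := by
      rw [isGE_iff]
      exact fun i hi => isZero_homology₁ hT i
        (isZero_of_isGE B (c + 1) (i - 1) (by omega)) (isZero_of_isGE _ c i hi)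
    have hmono := mono_homologyMap hT c (isZero_of_isGE B (c + 1) (c - 1) (by omega))
    obtain ⟨N, ⟨e⟩⟩ := exists_iso_singleFunctor_obj_of_isGE_of_isLE A c
    have hN : IsKilled S N := by
      have h0 := IsKilled.of_mono (hY c) ((homologyFunctor C c).map f)
      let e' := (homologyFunctor C c).mapIso e ≪≫ (singleFunctorCompHomologyFunctorIso C c).app N
      exact IsKilled.of_epi h0 e'.hom
    have h0 : f = 0 := by
      rw [← cancel_epi e.inv, h N hN c (by omega) (e.inv ≫ f), comp_zero]
    have hz : IsZero ((homologyFunctor C c).obj Y) := by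
      refine (exact₂ _ hT c).isZero_of_both_zeros ?_ ?_
      · change (homologyFunctor C c).map f = 0
        rw [h0, Functor.map_zero]
      · exact (isZero_of_isGE B (c + 1) c (by omega)).eq_of_tgt _ _
    rw [isGE_iff]
    intro i hi
    by_cases hic : i < c
    · exact isZero_of_isGE Y c i hic
    · obtain rfl : i = c := by push_cast at hc; omega
      exact hz

end HomVanishing

open DerivedCategory TStructure

/-! ### Passage to the singularity category -/

section Lift

variable {T : Type*} [Category* T] [HasZeroObject T] [HasShift T ℤ] [Preadditive T]
  [∀ n : ℤ, (shiftFunctor T n).Additive] [Pretriangulated T]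

theorem exists_lift_distinguished (P : ObjectProperty T) [P.IsTriangulated] {X Y Z : T}
    (hX : P X) (hY : P Y) (hZ : P Z) {f : X ⟶ Y} {g : Y ⟶ Z} {h : Z ⟶ X⟦(1 : ℤ)⟧}
    (hT : Triangle.mk f g h ∈ distTriang T) :
    ∃ h' : (⟨Z, hZ⟩ : P.FullSubcategory) ⟶ (⟨X, hX⟩ : P.FullSubcategory)⟦(1 : ℤ)⟧,
      Triangle.mk (ObjectProperty.homMk f : (⟨X, hX⟩ : P.FullSubcategory) ⟶ ⟨Y, hY⟩)
        (ObjectProperty.homMk g) h' ∈ distTriang P.FullSubcategory := by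
  let X' : P.FullSubcategory := ⟨X, hX⟩
  let Z' : P.FullSubcategory := ⟨Z, hZ⟩
  obtain ⟨k, hk⟩ : ∃ k : Z' ⟶ X'⟦(1 : ℤ)⟧,
      P.ι.map k = h ≫ (P.ι.commShiftIso (1 : ℤ)).inv.app X' :=
    ⟨_, P.fullyFaithfulι.map_preimage _⟩
  refine ⟨k, ?_⟩
  refine isomorphic_distinguished _ hT _
    (Triangle.isoMk _ _ (Iso.refl _) (Iso.refl _) (Iso.refl _) ?_ ?_ ?_)
  · exact (Category.comp_id _).trans (Category.id_comp _).symm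
  · exact (Category.comp_id _).trans (Category.id_comp _).symm
  · have h1 : P.ι.map k ≫ (P.ι.commShiftIso (1 : ℤ)).hom.app X' = h := by
      rw [hk, Category.assoc, Iso.inv_hom_id_app]
      exact Category.comp_id h
    have h2 : h ≫ (𝟙 X)⟦(1 : ℤ)⟧' = 𝟙 Z ≫ h := by
      rw [CategoryTheory.Functor.map_id, Category.comp_id, Category.id_comp]
    exact (congrArg (fun u => u ≫ (𝟙 X)⟦(1 : ℤ)⟧') h1).trans h2

end Lift

variable {R : Type u} [CommRing R] [IsNoetherianRing R]

/-- The image in the singularity category of a bounded object of the derived category. -/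
abbrev dsgOf (X : DerivedCategory (FGModuleCat.{u} R)) (hX : t.bounded X) : Dsg R :=
  (perfect R).trW.Q.obj ⟨X, hX⟩

theorem bounded_of_isGE_of_isLE (X : DerivedCategory (FGModuleCat.{u} R)) (a b : ℤ) [X.IsGE a]
    [X.IsLE b] : t.bounded X :=
  ⟨⟨a, inferInstance⟩, ⟨b, inferInstance⟩⟩

/-- The morphism in the singularity category induced by a morphism in the derived category. -/
abbrev dsgMap {X Y : DerivedCategory (FGModuleCat.{u} R)} (hX : t.bounded X) (hY : t.bounded Y)
    (f : X ⟶ Y) : dsgOf X hX ⟶ dsgOf Y hY :=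
  (perfect R).trW.Q.map (ObjectProperty.homMk f)

theorem exists_dsg_distinguished {X Y Z : DerivedCategory (FGModuleCat.{u} R)}
    (hX : t.bounded X) (hY : t.bounded Y) (hZ : t.bounded Z) {f : X ⟶ Y} {g : Y ⟶ Z}
    {h : Z ⟶ X⟦(1 : ℤ)⟧} (hT : Triangle.mk f g h ∈ distTriang _) :
    ∃ k, Triangle.mk (dsgMap hX hY f) (dsgMap hY hZ g) k ∈ distTriang (Dsg R) := by
  obtain ⟨k, hk⟩ := exists_lift_distinguished _ hX hY hZ hT
  exact ⟨_, (perfect R).trW.Q.map_distinguished _ hk⟩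

theorem nonempty_dsgOf_iso {X Y : DerivedCategory (FGModuleCat.{u} R)}
    (hX : t.bounded X) (hY : t.bounded Y) (e : X ≅ Y) : Nonempty (dsgOf X hX ≅ dsgOf Y hY) :=
  ⟨(perfect R).trW.Q.mapIso (t.bounded.isoMk e)⟩

theorem nonempty_dsgOf_shift_iso {X : DerivedCategory (FGModuleCat.{u} R)}
    (hX : t.bounded X) (n : ℤ) (hX' : t.bounded (X⟦n⟧)) :
    Nonempty (dsgOf (X⟦n⟧) hX' ≅ (dsgOf X hX)⟦n⟧) :=
  ⟨(perfect R).trW.Q.mapIso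
    (t.bounded.fullyFaithfulι.preimageIso ((t.bounded.ι.commShiftIso n).app ⟨X, hX⟩).symm) ≪≫
    ((perfect R).trW.Q.commShiftIso n).app ⟨X, hX⟩⟩

theorem bounded_single (N : FGModuleCat.{u} R) (b : ℤ) :
    t.bounded ((singleFunctor (FGModuleCat.{u} R) b).obj N) :=
  bounded_of_isGE_of_isLE _ b b

theorem nonempty_dsgOf_single_iso (N : FGModuleCat.{u} R) (b : ℤ) :
    Nonempty (dsgOf ((singleFunctor _ b).obj N) (bounded_single N b) ≅
      ((toDsg R).obj N)⟦(-b : ℤ)⟧) := by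
  have hs : t.bounded (((singleFunctor _ 0).obj N)⟦(-b : ℤ)⟧) :=
    (t.bounded.le_shift (-b : ℤ)) _ (bounded_single N 0)
  obtain ⟨e⟩ := nonempty_dsgOf_iso (bounded_single N b) hs
    (((singleFunctors _).shiftIso (-b) b 0 (by omega)).app N).symm
  obtain ⟨e'⟩ := nonempty_dsgOf_shift_iso (bounded_single N 0) (-b) hs
  exact ⟨e ≪≫ e'⟩

/-- Dévissage along truncations, one extension per degree of the interval [a, b]. It is applied with
balls for `W`, and with the constant family `LocallyZero p`. -/
theorem dsg_induction_of_homologyKilled {S : Set R} (W : ℕ → ObjectProperty (Dsg R))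
    (V : ObjectProperty (Dsg R)) [V.IsClosedUnderIsomorphisms] [V.IsStableUnderShift ℤ]
    (h0 : ∀ X, IsZero X → W 0 X)
    (hs : ∀ n, ∀ S ∈ distTriang (Dsg R), W n S.obj₁ → V S.obj₃ → W (n + 1) S.obj₂)
    (hV : ∀ N : FGModuleCat.{u} R, IsKilled S N → V ((toDsg R).obj N)) (n : ℕ) (a b : ℤ)
    (hn : b + 1 = a + n) (X : DerivedCategory (FGModuleCat.{u} R)) (hX : t.bounded X)
    [X.IsGE a] [X.IsLE b] (hk : HomologyKilled S X) : W n (dsgOf X hX) := by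
  induction n generalizing b X with
  | zero =>
    refine h0 _ (Functor.map_isZero _ ?_)
    have : IsZero X := t.isZero X b a (by push_cast at hn; omega)
    exact (IsZero.iff_id_eq_zero _).2 (ObjectProperty.hom_ext _ (this.eq_of_src _ _))
  | succ n ih =>
    push_cast at hn
    obtain ⟨X', N, f, g, h, hT, hX', hX'', hmono, e, he⟩ :=
      exists_truncation_triangle X a b (by omega)
    have hb := bounded_of_isGE_of_isLE X' a (b - 1)
    have hb' := bounded_single N b
    obtain ⟨k, hk'⟩ := exists_dsg_distinguished hb hX hb' hT
    refine hs n _ hk' (ih (b - 1) (by omega) X' hb fun i => (hk i).of_mono ((homologyFunctor _ i).map f)) ?_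
    obtain ⟨e'⟩ := nonempty_dsgOf_single_iso N b
    exact V.prop_of_iso e'.symm (V.le_shift _ _ (hV N ((hk b).of_epi e)))

section Linear

instance {C : Type*} [Category* C] (P : ObjectProperty C) {A : Type*} [AddMonoid A] [HasShift C A]
    [P.IsStableUnderShift A] [Preadditive C] {R : Type*} [Ring R] [Linear R C] (n : A)
    [(shiftFunctor C n).Linear R] : (shiftFunctor P.FullSubcategory n).Linear R where
  map_smul f r := by
    have := Functor.linear_of_iso R (P.ι.commShiftIso n).symm
    refine P.ι.map_injective ?_
    have h1 := CategoryTheory.Functor.map_smul (shiftFunctor P.FullSubcategory n ⋙ P.ι) r f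
    exact h1.trans (CategoryTheory.Functor.map_smul P.ι r _).symm

theorem IsKilled.map {R : Type*} [CommRing R] {S : Set R} {T T' : Type*} [Category* T]
    [Category* T'] [Preadditive T] [Linear R T] [Preadditive T'] [Linear R T'] (F : T ⥤ T')
    [F.Additive] [F.Linear R] {X : T} (h : IsKilled S X) : IsKilled S (F.obj X) := fun z hz => by
  rw [← CategoryTheory.Functor.map_id, ← F.map_smul, h z hz, F.map_zero]

theorem IsKilled.biprod {R : Type*} [CommRing R] {S : Set R} {T : Type*} [Category* T]
    [Preadditive T] [HasBinaryBiproducts T] [Linear R T] {X Y : T} (hX : IsKilled S X)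
    (hY : IsKilled S Y) : IsKilled S (X ⊞ Y) := fun z hz => by
  rw [← biprod.total, smul_add, ← Linear.smul_comp, ← Linear.smul_comp,
    hX.smul_eq_zero_right hz, hY.smul_eq_zero_right hz, zero_comp, zero_comp, add_zero]

variable {T : Type*} [Category* T] [HasZeroObject T] [HasShift T ℤ]
  [Preadditive T] [∀ n : ℤ, (shiftFunctor T n).Additive] [Pretriangulated T]

theorem nonempty_iso_biprod_of_distinguished_zero {X K : T} {g : X ⟶ K} {h : K ⟶ X⟦(1 : ℤ)⟧}
    (hT : Triangle.mk (0 : X ⟶ X) g h ∈ distTriang T) : Nonempty (K ≅ X ⊞ X⟦(1 : ℤ)⟧) := by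
  obtain ⟨e, -⟩ := exists_iso_binaryBiproduct_of_distTriang _ (rot_of_distTriang _ hT)
    (by change -((0 : X ⟶ X)⟦(1 : ℤ)⟧') = 0; rw [Functor.map_zero, neg_zero])
  exact ⟨e⟩

end Linear

/-! ### Koszul objects as iterated mapping cones -/

section Koszul

open CochainComplex HomComplex

variable {R : Type*} [CommRing R] {C : Type*} [Category* C] [Abelian C] [Linear R C]

/-- Multiplication by `z` is null-homotopic on the complex `K`. -/
def NullHomotopic (z : R) (K : CochainComplex C ℤ) : Prop :=
  ∃ γ : Cochain K K (-1), δ (-1) 0 γ = z • Cochain.ofHom (𝟙 K)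

theorem ofHom_smul (z : R) {K L : CochainComplex C ℤ} (f : K ⟶ L) :
    Cochain.ofHom (z • f) = z • Cochain.ofHom f := by
  ext; simp

theorem nullHomotopic_mappingCone (z : R) (K : CochainComplex C ℤ) :
    NullHomotopic z (mappingCone (z • 𝟙 K)) := by
  -- The homotopy sends the copy of `K` in the cone identically to the shifted copy.
  refine ⟨(mappingCone.snd (z • 𝟙 K)).comp (mappingCone.inl (z • 𝟙 K)) (zero_add (-1)), ?_⟩
  rw [← mappingCone.id, δ_comp _ _ (zero_add (-1)) 1 0 0 (by omega) (by omega) (by omega),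
    mappingCone.δ_inl, mappingCone.δ_snd]
  simp [ofHom_smul]
  abel

theorem NullHomotopic.mappingCone {y : R} {K : CochainComplex C ℤ} (h : NullHomotopic y K) (z : R) :
    NullHomotopic y (mappingCone (z • 𝟙 K)) := by
  obtain ⟨γ, hγ⟩ := h
  -- The old homotopy acts on both summands of the cone, with a sign on the shifted one.
  refine ⟨((mappingCone.snd (z • 𝟙 K)).comp γ (zero_add (-1))).comp
      (Cochain.ofHom (mappingCone.inr (z • 𝟙 K))) (add_zero (-1)) -
    ((mappingCone.fst (z • 𝟙 K)).1.comp γ (by omega : (1 : ℤ) + (-1) = 0)).comp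
      (mappingCone.inl (z • 𝟙 K)) (zero_add (-1)), ?_⟩
  rw [← mappingCone.id, δ_sub, δ_comp _ _ (zero_add (-1)) 1 0 0 (by omega) (by omega) (by omega),
    δ_comp _ _ (add_zero (-1)) 0 1 0 (by omega) (by omega) (by omega), 
    δ_comp _ _ (zero_add (-1)) 1 0 0 (by omega) (by omega) (by omega),
    δ_comp _ _ (by omega : (1 : ℤ) + (-1) = 0) 2 0 1 (by omega) (by omega) (by omega),
    mappingCone.δ_inl, mappingCone.δ_snd, hγ]
  simp [ofHom_smul]
  abel

open DerivedCategory in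
theorem NullHomotopic.homology_smul_eq_zero [HasDerivedCategory C] {z : R}
    {K : CochainComplex C ℤ} (h : NullHomotopic z K) (i : ℤ) :
    z • 𝟙 ((homologyFunctor C i).obj (Q.obj K)) = 0 := by
  obtain ⟨γ, hγ⟩ := h
  have h : IsKilled {z} (K.homology i) := by
    intro z' hz
    rw [Set.mem_singleton_iff.1 hz]
    have ho : Homotopy (z • 𝟙 K) 0 := (Cochain.equivHomotopy _ _).symm
      ⟨γ, by rw [hγ, ofHom_smul, Cochain.ofHom_zero, add_zero]⟩
    have h1 := ho.homologyMap_eq i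
    rw [HomologicalComplex.homologyMap_zero] at h1
    have h2 : HomologicalComplex.homologyMap (z • 𝟙 K) i =
        z • HomologicalComplex.homologyMap (𝟙 K) i :=
      ShortComplex.homologyMap_smul
        ((HomologicalComplex.shortComplexFunctor C (ComplexShape.up ℤ) i).map (𝟙 K)) z
    rw [← h1, h2, HomologicalComplex.homologyMap_id]
  let e : (homologyFunctor C i).obj (Q.obj K) ≅ K.homology i :=
    (homologyFunctorFactors C i).app K
  exact h.of_epi e.inv z rfl

end Koszul

section KoszulDsg

open CochainComplex DerivedCategory TStructure

theorem exists_mappingCone_smul_distinguished {R : Type*} [CommRing R] {C : Type*} [Category* C]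
    [Abelian C] [Linear R C] [HasDerivedCategory C] (z : R) (K : CochainComplex C ℤ) :
    ∃ h, Triangle.mk (z • 𝟙 (Q.obj K)) (Q.map (mappingCone.inr (z • 𝟙 K))) h ∈ distTriang _ := by
  have h := mappingCone_triangle_distinguished (z • 𝟙 K)
  have h1 : Q.map (z • 𝟙 K) = z • 𝟙 (Q.obj K) := by
    rw [CategoryTheory.Functor.map_smul, CategoryTheory.Functor.map_id]
  rw [← h1]
  exact ⟨_, h⟩

variable {R : Type u} [CommRing R] [IsNoetherianRing R]

theorem nonempty_dsgOf_iso_biprod {X K : DerivedCategory (FGModuleCat.{u} R)} (hX : t.bounded X)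
    (hK : t.bounded K) {z : R} {g : X ⟶ K} {h : K ⟶ X⟦(1 : ℤ)⟧}
    (hT : Triangle.mk (z • 𝟙 X) g h ∈ distTriang _) (hz : z • 𝟙 (dsgOf X hX) = 0) :
    Nonempty (dsgOf K hK ≅ dsgOf X hX ⊞ (dsgOf X hX)⟦(1 : ℤ)⟧) := by
  obtain ⟨k, hk⟩ := exists_dsg_distinguished hX hX hK hT
  have h0 : dsgMap hX hX (z • 𝟙 X) = 0 := by
    rw [← hz, ← CategoryTheory.Functor.map_id, ← CategoryTheory.Functor.map_smul]
    rfl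
  rw [h0] at hk
  exact nonempty_iso_biprod_of_distinguished_zero hk

/-- Each cone costs one degree at the bottom and in the vanishing range, none at the top, and
contains the previous object as a summand in `D_sg(R)` because `z` is zero there. Actual complexes
are used so that null-homotopies persist through later cones. -/
theorem exists_koszul (S : Set R) (zs : List R) (K : CochainComplex (FGModuleCat.{u} R) ℤ)
    (a b d : ℤ) [(Q.obj K).IsGE a] [(Q.obj K).IsLE b] (hK : t.bounded (Q.obj K))
    (hv : HomVanish S (Q.obj K) d) (hk : IsKilled {z | z ∈ zs} (dsgOf (Q.obj K) hK)) :
    ∃ (K' : CochainComplex (FGModuleCat.{u} R) ℤ) (hK' : t.bounded (Q.obj K')),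
      (Q.obj K').IsGE (a - zs.length) ∧ (Q.obj K').IsLE b ∧
      HomVanish S (Q.obj K') (d - zs.length) ∧ (∀ z ∈ zs, NullHomotopic z K') ∧
      (∀ y : R, NullHomotopic y K → NullHomotopic y K') ∧
      Nonempty (Retract (dsgOf (Q.obj K) hK) (dsgOf (Q.obj K') hK')) := by
  induction zs generalizing K a d with
  | nil => exact ⟨K, hK, by simpa, inferInstance, by simpa, by simp, fun _ h => h, ⟨.refl _⟩⟩
  | cons z zs ih =>
    obtain ⟨h, hT⟩ := exists_mappingCone_smul_distinguished z K
    set K₁ := mappingCone (z • 𝟙 K)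
    have hGE : (Q.obj K₁).IsGE (a - 1) := by
      rw [DerivedCategory.isGE_iff]
      exact fun i hi => isZero_homology₃ hT i (isZero_of_isGE _ a i (by omega))
        (isZero_of_isGE _ a _ (by omega))
    have hLE : (Q.obj K₁).IsLE b := by
      rw [DerivedCategory.isLE_iff]
      exact fun i hi => isZero_homology₃ hT i (isZero_of_isLE _ b i (by omega))
        (isZero_of_isLE _ b _ (by omega))
    have hK₁ := bounded_of_isGE_of_isLE (Q.obj K₁) (a - 1) b
    obtain ⟨e⟩ := nonempty_dsgOf_iso_biprod hK hK₁ hT (hk z (by simp))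
    have hk' : IsKilled {z | z ∈ zs} (dsgOf (Q.obj K) hK) :=
      fun y hy => hk y (List.mem_cons_of_mem _ hy)
    have hk₁ : IsKilled {z | z ∈ zs} (dsgOf (Q.obj K₁) hK₁) :=
      (hk'.biprod (hk'.map (CategoryTheory.shiftFunctor (Dsg R) (1 : ℤ)))).retract (.ofIso e)
    obtain ⟨K', hK', h1, h2, h3, h4, h5, ⟨r⟩⟩ := ih K₁ (a - 1) (d - 1) hK₁
      (HomVanish.obj₃ hT (by simpa using hv) (hv.of_le (by omega))) hk₁
    refine ⟨K', hK', ?_, h2, ?_, ?_, fun y hy => h5 y (hy.mappingCone z), ⟨?_⟩⟩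
    · convert h1 using 1; rw [List.length_cons]; push_cast; ring
    · convert h3 using 1; rw [List.length_cons]; push_cast; ring
    · rintro y hy
      rcases List.mem_cons.1 hy with rfl | hy
      · exact h5 _ (nullHomotopic_mappingCone _ K)
      · exact h4 y hy
    · exact ((⟨biprod.inl, biprod.fst, by simp⟩ : Retract (dsgOf (Q.obj K) hK) _).trans
        (.ofIso e.symm)).trans r

end KoszulDsg

section Killed

variable {R : Type*} [CommRing R] {S : Set R} {C : Type*} [Category* C] [Preadditive C]
    [Linear R C] {X Y : C}

theorem IsKilled.span (h : IsKilled S X) : IsKilled (Ideal.span S : Set R) X := fun z hz => by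
  have : S ⊆ Module.annihilator R (X ⟶ X) := fun z hz => by
    rw [SetLike.mem_coe, Module.mem_annihilator]
    exact fun f => h.smul_eq_zero_left hz f
  exact Module.mem_annihilator.1 (Ideal.span_le.2 this hz) _

theorem IsKilled.exists_pow_smul_eq_zero (h : IsKilled S X) {y : R}
    (hy : y ∈ (Ideal.span S).radical) (f : X ⟶ Y) : ∃ m : ℕ, y ^ m • f = 0 := by
  obtain ⟨m, hm⟩ := hy
  exact ⟨m, h.span.smul_eq_zero_left hm f⟩

end Killed

/-! ### Grade and vanishing of Hom -/

section RegularSequence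

open DerivedCategory TStructure

variable {R : Type u} [CommRing R] [IsNoetherianRing R] {S : Set R}

/-- Rees' argument: by induction Hom into (M/yM)[-1] vanishes in the relevant range, so `y` acts
injectively on Hom(N[-j], M). A power of `y` annihilates N, hence that Hom is zero. -/
theorem homVanish_single_zero (rs : List R) (hrad : ∀ y ∈ rs, y ∈ (Ideal.span S).radical)
    (M : FGModuleCat.{u} R) (hM : RingTheory.Sequence.IsWeaklyRegular M rs) :
    HomVanish S ((singleFunctor _ 0).obj M) rs.length := by
  induction rs generalizing M with
  | nil => exact .of_isGE _ _
  | cons y rs ih =>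
    rw [RingTheory.Sequence.isWeaklyRegular_cons_iff] at hM
    let M' : FGModuleCat.{u} R := FGModuleCat.of R (QuotSMulTop y M)
    have hM' := ih (fun z hz => hrad z (List.mem_cons_of_mem _ hz)) M' hM.2
    let g : M ⟶ M' := FGModuleCat.ofHom (Submodule.mkQ _)
    obtain ⟨w, hS⟩ := shortExact_of_linearMap (y • 𝟙 M) g hM.1 (Submodule.mkQ_surjective _) (by
      intro m
      change (Submodule.mkQ _ m = 0) ↔ ∃ n : M, y • n = m
      rw [Submodule.mkQ_apply, Submodule.Quotient.mk_eq_zero,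
        Submodule.mem_smul_pointwise_iff_exists]
      simp)
    have hT := hS.singleTriangle_distinguished
    have hinj : ∀ (N : FGModuleCat.{u} R), IsKilled S N → ∀ j < ((y :: rs).length : ℤ),
        ∀ f : (singleFunctor _ j).obj N ⟶ (singleFunctor _ 0).obj M, y • f = 0 → f = 0 := by
      intro N hN j hj f hf
      obtain ⟨k, hk⟩ := Triangle.coyoneda_exact₂ _ (inv_rot_of_distTriang _ hT) f (by
        change f ≫ (singleFunctor _ 0).map (y • 𝟙 M) = 0
        rw [CategoryTheory.Functor.map_smul, CategoryTheory.Functor.map_id, Linear.comp_smul,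
          Category.comp_id, hf])
      have hk0 : k = 0 := hM'.shift (-1) ((y :: rs).length : ℤ)
        (by rw [List.length_cons]; push_cast; ring) N hN j hj k
      rw [hk, hk0]
      exact zero_comp
    intro N hN j hj f
    obtain ⟨m, hm⟩ := (hN.map (singleFunctor (FGModuleCat.{u} R) j)).exists_pow_smul_eq_zero
      (hrad y (by simp)) f
    induction m with
    | zero => simpa using hm
    | succ m ihm =>
      refine ihm (hinj N hN j hj _ ?_)
      rw [smul_smul, ← pow_succ', hm]

/-- The free module of rank `r`, as an object of the category of finitely generated modules. -/
abbrev freeFG (R : Type u) [CommRing R] (r : ℕ) : FGModuleCat.{u} R := FGModuleCat.of R (Fin r → R)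

theorem homVanish_single_free (rs : List R) (hrad : ∀ y ∈ rs, y ∈ (Ideal.span S).radical)
    (hR : RingTheory.Sequence.IsWeaklyRegular R rs) (r : ℕ) (b : ℤ) :
    HomVanish S ((singleFunctor _ b).obj (freeFG R r)) (b + rs.length) := by
  have h := homVanish_single_zero rs hrad (freeFG R r)
    (((TensorProduct.lid R (Fin r → R)).isWeaklyRegular_congr rs).1
      (hR.isWeaklyRegular_rTensor (M₂ := Fin r → R)))
  exact (h.shift (-b) (b + rs.length) (by ring)).of_iso
    (((singleFunctors _).shiftIso (-b) b 0 (by omega)).app _)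

end RegularSequence

/-! ### Lowering the top degree by free modules -/

section FreeApproximation

open DerivedCategory TStructure HomologySequence

variable {R : Type u} [CommRing R] [IsNoetherianRing R] {S : Set R}

theorem exists_free_epi (M : FGModuleCat.{u} R) : ∃ (r : ℕ) (f : freeFG R r ⟶ M), Epi f := by
  obtain ⟨r, f, hf⟩ := Module.Finite.exists_fin' R M
  refine ⟨r, FGModuleCat.ofHom f, ?_⟩
  let F := forget₂ (FGModuleCat.{u} R) (ModuleCat.{u} R)
  have : Epi (F.map (FGModuleCat.ofHom f)) := (ModuleCat.epi_iff_surjective _).2 hf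
  exact F.epi_of_epi_map this

/-- With zero outgoing differential all of `K.X b` consists of cycles, so covering it covers the
homology. -/
theorem epi_homologyMap_mkHomFromSingle {C : Type*} [Category* C] [Abelian C]
    (K : CochainComplex C ℤ) (b : ℤ) (hd : K.d b (b + 1) = 0) {A : C} (p : A ⟶ K.X b) [Epi p]
    (hp : ∀ k, (ComplexShape.up ℤ).Rel b k → p ≫ K.d b k = 0) :
    Epi (HomologicalComplex.homologyMap (HomologicalComplex.mkHomFromSingle p hp) b) := by
  let L := (HomologicalComplex.single C (ComplexShape.up ℤ) b).obj A
  have : IsIso (K.iCycles b) := K.isIso_iCycles b (b + 1) (by simp) hd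
  have : IsIso (L.iCycles b) := L.isIso_iCycles b (b + 1) (by simp) (by simp [L])
  have h1 : Epi (HomologicalComplex.cyclesMap (HomologicalComplex.mkHomFromSingle p hp) b ≫
      K.iCycles b) := by
    rw [HomologicalComplex.cyclesMap_i, HomologicalComplex.mkHomFromSingle_f]
    infer_instance
  have h2 : Epi (HomologicalComplex.cyclesMap (HomologicalComplex.mkHomFromSingle p hp) b) := by
    have h3 := epi_comp (HomologicalComplex.cyclesMap (HomologicalComplex.mkHomFromSingle p hp) b ≫
      K.iCycles b) (inv (K.iCycles b))
    rwa [Category.assoc, IsIso.hom_inv_id, Category.comp_id] at h3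
  have h4 : Epi (L.homologyπ b ≫
      HomologicalComplex.homologyMap (HomologicalComplex.mkHomFromSingle p hp) b) := by
    rw [HomologicalComplex.homologyπ_naturality]
    infer_instance
  exact epi_of_epi (L.homologyπ b) _

theorem exists_free_approximation (X : DerivedCategory (FGModuleCat.{u} R)) (b : ℤ) [X.IsLE b] :
    ∃ (r : ℕ) (Y : DerivedCategory (FGModuleCat.{u} R))
      (f : (singleFunctor _ b).obj (freeFG R r) ⟶ X) (g : X ⟶ Y) (h : Y ⟶ _),
      Triangle.mk f g h ∈ distTriang _ ∧ Y.IsLE (b - 1) := by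
  obtain ⟨K, hK, ⟨e⟩⟩ := exists_iso_Q_obj_of_isLE X b
  obtain ⟨r, p, hp⟩ := exists_free_epi (K.X b)
  have hz : IsZero (K.X (b + 1)) := K.isZero_of_isStrictlyLE b _ (by omega)
  have hd : K.d b (b + 1) = 0 := hz.eq_of_tgt _ _
  have hp' : ∀ k, (ComplexShape.up ℤ).Rel b k → p ≫ K.d b k = 0 := fun k hk => by
    obtain rfl : b + 1 = k := hk
    rw [hd, comp_zero]
  let φ := HomologicalComplex.mkHomFromSingle p hp'
  have hφ : Epi ((homologyFunctor _ b).map (Q.map φ)) := by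
    have h2 : Epi ((HomologicalComplex.homologyFunctor _ (ComplexShape.up ℤ) b).map φ) :=
      epi_homologyMap_mkHomFromSingle K b hd p hp'
    exact ((MorphismProperty.epimorphisms _).arrow_mk_iso_iff
      (((Functor.mapArrowFunctor _ _).mapIso (homologyFunctorFactors (FGModuleCat.{u} R) b)).app
        (Arrow.mk φ))).2 h2
  obtain ⟨Y, g, h, hT⟩ := distinguished_cocone_triangle (Q.map φ ≫ e.inv)
  refine ⟨r, Y, Q.map φ ≫ e.inv, g, h, hT, ?_⟩
  have hφ' : Epi ((homologyFunctor _ b).map (Q.map φ ≫ e.inv)) := by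
    rw [Functor.map_comp]
    infer_instance
  rw [isLE_iff]
  intro i hi
  rcases (show b < i ∨ b = i by omega) with hi | rfl
  · exact isZero_homology₃ hT i (isZero_of_isLE X b i hi) (isZero_of_isLE _ b (i + 1) (by omega))
  · have hg := epi_homologyMap hT b (isZero_of_isLE _ b (b + 1) (by omega))
    refine IsZero.of_epi_eq_zero ((homologyFunctor _ b).map g) ?_
    rw [← cancel_epi ((homologyFunctor _ b).map (Q.map φ ≫ e.inv)), comp_zero, ← Functor.map_comp]
    have h0 : (Q.map φ ≫ e.inv) ≫ g = 0 := comp_distTriang_mor_zero₁₂ _ hT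
    rw [h0, Functor.map_zero]

instance : (toDb R).Additive where
  map_add {_ _ _ _} := ObjectProperty.hom_ext _ (singleFunctor (FGModuleCat.{u} R) 0).map_add

instance : (toDb R).Linear R where
  map_smul f r := ObjectProperty.hom_ext _
    (CategoryTheory.Functor.map_smul (singleFunctor (FGModuleCat.{u} R) 0) r f)

instance : (toDsg R).Additive := inferInstanceAs (toDb R ⋙ (perfect R).trW.Q).Additive

instance : (toDsg R).Linear R := inferInstanceAs ((toDb R ⋙ (perfect R).trW.Q).Linear R)

open ZeroObject in
theorem isZero_of_perfect (X : Db R) (hX : perfect R X) : IsZero ((perfect R).trW.Q.obj X) := by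
  have h : (perfect R).trW (0 : (0 : Db R) ⟶ X) := by
    refine ⟨X, 𝟙 X, 0, ?_, hX⟩
    exact contractible_distinguished₁ X
  have := Localization.inverts (perfect R).trW.Q (perfect R).trW _ h
  exact ((perfect R).trW.Q.map_isZero (isZero_zero _)).of_iso (asIso ((perfect R).trW.Q.map 0)).symm

theorem isZero_toDsg_free (r : ℕ) : IsZero ((toDsg R).obj (freeFG R r)) := by
  have h0 : IsZero ((toDsg R).obj (FGModuleCat.of R R)) :=
    isZero_of_perfect _ (ObjectProperty.le_triangEnvelope _ _ (by simp))
  let p (i : Fin r) : freeFG R r ⟶ FGModuleCat.of R R := FGModuleCat.ofHom (LinearMap.proj i)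
  let s (i : Fin r) : FGModuleCat.of R R ⟶ freeFG R r :=
    FGModuleCat.ofHom (LinearMap.single R (fun _ => R) i)
  have h : 𝟙 (freeFG R r) = ∑ i, p i ≫ s i := by
    refine (forget₂ (FGModuleCat.{u} R) (ModuleCat.{u} R)).map_injective ?_
    rw [Functor.map_sum]
    refine ModuleCat.hom_ext (LinearMap.ext fun v => ?_)
    rw [ModuleCat.hom_sum, LinearMap.sum_apply]
    exact (Finset.univ_sum_single v).symm
  rw [IsZero.iff_id_eq_zero, ← CategoryTheory.Functor.map_id, h, Functor.map_sum]
  refine Finset.sum_eq_zero fun i _ => ?_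
  rw [Functor.map_comp, h0.eq_of_tgt ((toDsg R).map (p i)) 0, zero_comp]

theorem isZero_dsgOf_free (r : ℕ) (b : ℤ) :
    IsZero (dsgOf _ (bounded_single (freeFG R r) b)) := by
  obtain ⟨e⟩ := nonempty_dsgOf_single_iso (freeFG R r) b
  exact ((shiftFunctor (Dsg R) (-b : ℤ)).map_isZero (isZero_toDsg_free r)).of_iso e

/-- The cone of a free module covering the top homology is isomorphic to `X` in `D_sg(R)` and has
lower top degree. The process stops where the grade can no longer protect the vanishing range. -/
theorem exists_dsgOf_iso_isLE (rs : List R) (hrad : ∀ y ∈ rs, y ∈ (Ideal.span S).radical)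
    (hR : RingTheory.Sequence.IsWeaklyRegular R rs) (a : ℤ) (n : ℕ)
    (X : DerivedCategory (FGModuleCat.{u} R)) (hX : t.bounded X) [X.IsLE (a - rs.length + n)]
    (hv : HomVanish S X a) :
    ∃ (Y : DerivedCategory (FGModuleCat.{u} R)) (hY : t.bounded Y),
      Y.IsLE (a - rs.length) ∧ HomVanish S Y a ∧ Nonempty (dsgOf X hX ≅ dsgOf Y hY) := by
  induction n generalizing X with
  | zero => exact ⟨X, hX, t.isLE_of_le X (a - rs.length + (0 : ℕ)) _ (by simp), hv, ⟨Iso.refl _⟩⟩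
  | succ n ih =>
    obtain ⟨r, Y, f, g, h, hT, hY⟩ := exists_free_approximation X (a - rs.length + (n + 1 : ℕ))
    have hYb : t.bounded Y := t.bounded.ext_of_isTriangulatedClosed₃ _ hT (bounded_single _ _) hX
    have hY' : Y.IsLE (a - rs.length + n) := by
      convert hY using 1; push_cast; ring
    -- The free module sits in degree a - g + n + 1, so Hom into it vanishes below a + n + 1; the
    -- cone requires vanishing below a + 1.
    have hvY : HomVanish S Y a := HomVanish.obj₃ hT
      ((homVanish_single_free rs hrad hR r _).of_le (by push_cast; omega)) hv
    obtain ⟨Z, hZ, h1, h2, ⟨e⟩⟩ := ih Y hYb hvY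
    obtain ⟨k, hk⟩ := exists_dsg_distinguished (bounded_single _ _) hX hYb hT
    have : IsIso (dsgMap hX hYb g) :=
      (Triangle.isZero₁_iff_isIso₂ _ hk).1 (isZero_dsgOf_free r _)
    exact ⟨Z, hZ, h1, h2, ⟨asIso (dsgMap hX hYb g) ≪≫ e⟩⟩

end FreeApproximation

/-! ### The ball containing an annihilated object -/

section Main

open DerivedCategory TStructure

variable {R : Type u} [CommRing R] [IsNoetherianRing R]

theorem ball_of_isKilled (zs rs : List R) (hR : RingTheory.Sequence.IsWeaklyRegular R rs)
    (hrad : ∀ y ∈ rs, y ∈ (Ideal.span {z | z ∈ zs}).radical) (hle : rs.length ≤ zs.length)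
    (P : ObjectProperty (Dsg R))
    (hP : ∀ N : FGModuleCat.{u} R, IsKilled {z | z ∈ zs} N → bracket P ((toDsg R).obj N))
    (X : Dsg R) (hX : IsKilled {z | z ∈ zs} X) : ball P (zs.length - rs.length + 1) X := by
  obtain ⟨⟨X₀, hX₀⟩, ⟨e⟩⟩ : ∃ X₀, Nonempty ((perfect R).trW.Q.obj X₀ ≅ X) :=
    ⟨_, ⟨(perfect R).trW.Q.objObjPreimageIso X⟩⟩
  obtain ⟨⟨a, ha⟩, ⟨b, hb⟩⟩ := id hX₀
  have hb' : X₀.IsLE (a - rs.length + (b - (a - rs.length)).toNat) :=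
    t.isLE_of_le X₀ b _ (by omega)
  obtain ⟨Y, hY, hYle, hYv, ⟨e₁⟩⟩ :=
    exists_dsgOf_iso_isLE rs hrad hR a (b - (a - rs.length)).toNat X₀ hX₀ (.of_isGE X₀ a)
  let K := Q.objPreimage Y
  let eK : Q.obj K ≅ Y := Q.objObjPreimageIso Y
  obtain ⟨⟨c, hc⟩, -⟩ := id hY
  have hK₁ : (Q.obj K).IsGE c := t.isGE_of_iso eK.symm c
  have hK₂ : (Q.obj K).IsLE (a - rs.length) := t.isLE_of_iso eK.symm _
  have hK : t.bounded (Q.obj K) := ⟨⟨c, hK₁⟩, ⟨_, hK₂⟩⟩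
  obtain ⟨e₂⟩ := nonempty_dsgOf_iso hY hK eK.symm
  let e' := e.symm ≪≫ e₁ ≪≫ e₂
  have hkill : IsKilled {z | z ∈ zs} (dsgOf (Q.obj K) hK) := hX.retract (.ofIso e'.symm)
  obtain ⟨K', hK', h1, h2, h3, h4, -, ⟨r⟩⟩ :=
    exists_koszul _ zs K c (a - rs.length) a hK (hYv.of_iso eK.symm) hkill
  have hhk : HomologyKilled {z | z ∈ zs} (Q.obj K') :=
    fun i z hz => (h4 z hz).homology_smul_eq_zero i
  have hGE := isGE_of_homVanish (Q.obj K') (c - zs.length) (a - zs.length) hhk h3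
  have : (bracket P).IsClosedUnderIsomorphisms := ⟨fun e => (isAddShiftClosed_bracket P).of_iso e⟩
  have : (bracket P).IsStableUnderShift ℤ :=
    ⟨fun n => ⟨fun _ h => (isAddShiftClosed_bracket P).shift n h⟩⟩
  -- The homology of `K'` is confined to the degrees from a - `zs.length` to a - `rs.length`, which
  -- gives the radius.
  have h5 := dsg_induction_of_homologyKilled (ball P) (bracket P) (fun _ h => h)
    (fun n T hT h₁ h₃ => ball_succ_of_distinguished T hT h₁ h₃) hP
    (zs.length - rs.length + 1) (a - zs.length) (a - rs.length) (by push_cast [hle]; ring)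
    (Q.obj K') hK' hhk
  exact (isAddShiftClosed_ball P _).retract ((Retract.ofIso e').trans r) h5

end Main

/-! ### Vanishing of `D_sg(R)` at regular primes -/

section LocallyZero

variable {R : Type u} [CommRing R] [IsNoetherianRing R] (p : Ideal R)

/-- Some element outside of `p` annihilates the object `X` of the singularity category. -/
def LocallyZero : ObjectProperty (Dsg R) := fun X => ∃ s ∉ p, s • 𝟙 X = 0

instance : (LocallyZero p).IsClosedUnderIsomorphisms where
  of_iso e := fun ⟨s, hs, h⟩ => ⟨s, hs, by
    rw [← e.inv_hom_id, ← Linear.smul_comp, ← Category.comp_id e.inv, ← Linear.comp_smul, h]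
    simp⟩

instance : (LocallyZero p).IsStableUnderShift ℤ where
  isStableUnderShiftBy n := ⟨fun X ⟨s, hs, h⟩ => ⟨s, hs, by
    rw [← CategoryTheory.Functor.map_id, ← CategoryTheory.Functor.map_smul, h, Functor.map_zero]⟩⟩

variable {p}

theorem locallyZero_of_isZero [p.IsPrime] {X : Dsg R} (h : IsZero X) : LocallyZero p X :=
  ⟨1, fun h1 => Ideal.IsPrime.ne_top' ((Ideal.eq_top_iff_one p).2 h1), h.eq_of_src _ _⟩

theorem LocallyZero.obj₂ [p.IsPrime] {T : Triangle (Dsg R)} (hT : T ∈ distTriang (Dsg R))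
    (h₁ : LocallyZero p T.obj₁) (h₃ : LocallyZero p T.obj₃) : LocallyZero p T.obj₂ := by
  obtain ⟨s, hs, h⟩ := h₁
  obtain ⟨s', hs', h'⟩ := h₃
  refine ⟨s * s', fun hm => (Ideal.IsPrime.mem_or_mem ‹_› hm).elim hs hs', ?_⟩
  obtain ⟨k, hk⟩ := Triangle.coyoneda_exact₂ T hT (s' • 𝟙 T.obj₂) (by
    rw [Linear.smul_comp, Category.id_comp, ← Category.comp_id T.mor₂, ← Linear.comp_smul, h',
      comp_zero])
  rw [mul_smul, hk, ← Linear.comp_smul, ← Category.id_comp T.mor₁, ← Linear.smul_comp, h,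
    zero_comp, comp_zero]

theorem LocallyZero.obj₃ [p.IsPrime] {T : Triangle (Dsg R)} (hT : T ∈ distTriang (Dsg R))
    (h₁ : LocallyZero p T.obj₁) (h₂ : LocallyZero p T.obj₂) : LocallyZero p T.obj₃ :=
  LocallyZero.obj₂ (rot_of_distTriang _ hT) h₂ ((LocallyZero p).le_shift (1 : ℤ) _ h₁)

theorem exists_toDsg_distinguished {S : ShortComplex (FGModuleCat.{u} R)} (hS : S.ShortExact) :
    ∃ k, Triangle.mk ((toDsg R).map S.f) ((toDsg R).map S.g) k ∈ distTriang (Dsg R) :=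
  exists_dsg_distinguished (bounded_single S.X₁ 0) (bounded_single S.X₂ 0) (bounded_single S.X₃ 0)
    hS.singleTriangle_distinguished

/-- In `D_sg(R)` a syzygy is a shift of the module, which reduces to `N` locally free at `p`. There
multiplication by some s ∉ p factors through a free module, hence through zero. -/
theorem locallyZero_toDsg [p.IsPrime] (n : ℕ) (N : FGModuleCat.{u} R)
    (h : HasFreeSyzygy (Localization.AtPrime p) n (LocalizedModule p.primeCompl N)) :
    LocallyZero p ((toDsg R).obj N) := by
  induction n generalizing N with
  | zero =>
    obtain ⟨s, hs, r, g, f, hfg⟩ := exists_notMem_comp_eq_smul p h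
    refine ⟨s, hs, ?_⟩
    have h1 : s • 𝟙 N = FGModuleCat.ofHom g ≫ (FGModuleCat.ofHom f : freeFG R r ⟶ N) := by
      ext x
      exact (LinearMap.congr_fun hfg x).symm
    rw [← CategoryTheory.Functor.map_id, ← CategoryTheory.Functor.map_smul, h1, Functor.map_comp,
      (isZero_toDsg_free r).eq_of_tgt ((toDsg R).map (FGModuleCat.ofHom g)) 0, zero_comp]
  | succ n ih =>
    obtain ⟨r, f, hf⟩ := Module.Finite.exists_fin' R N
    obtain ⟨w, hS⟩ := shortExact_of_linearMap (N₁ := .of R (LinearMap.ker f))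
      (N₂ := freeFG R r) (N₃ := N) (FGModuleCat.ofHom (LinearMap.ker f).subtype)
      (FGModuleCat.ofHom f) (Submodule.subtype_injective _) hf (LinearMap.exact_subtype_ker_map f)
    obtain ⟨k, hk⟩ := exists_toDsg_distinguished hS
    exact LocallyZero.obj₃ hk (ih _ (h.localizedModule_ker p f hf))
      (locallyZero_of_isZero (isZero_toDsg_free r))

theorem locallyZero_of_isRegularLocalRing [p.IsPrime]
    (hp : IsRegularLocalRing (Localization.AtPrime p)) (X : Dsg R) : LocallyZero p X := by
  obtain ⟨⟨X₀, hX₀⟩, ⟨e⟩⟩ : ∃ X₀, Nonempty ((perfect R).trW.Q.obj X₀ ≅ X) :=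
    ⟨_, ⟨(perfect R).trW.Q.objObjPreimageIso X⟩⟩
  refine (LocallyZero p).prop_of_iso e ?_
  obtain ⟨⟨a, ha⟩, ⟨b, hb⟩⟩ := id hX₀
  -- The minimum keeps the number of truncation steps nonnegative even if a > b + 1.
  have ha' : X₀.IsGE (min a (b + 1)) := DerivedCategory.TStructure.t.isGE_of_ge X₀ _ a (by omega)
  obtain ⟨d', hd'⟩ := WithBot.ne_bot_iff_exists.1
    (ringKrullDim_ne_bot (R := Localization.AtPrime p))
  obtain ⟨d, rfl⟩ := ENat.ne_top_iff_exists.1 fun h : d' = ⊤ =>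
    ringKrullDim_ne_top (R := Localization.AtPrime p) (by rw [← hd', h]; rfl)
  have hd : ringKrullDim (Localization.AtPrime p) = d := hd'.symm
  refine dsg_induction_of_homologyKilled (S := (∅ : Set R)) (fun _ => LocallyZero p) (LocallyZero p)
    (fun X hX => locallyZero_of_isZero hX) (fun n T hT h₁ h₃ => .obj₂ hT h₁ h₃)
    (fun N _ => locallyZero_toDsg d N (hasFreeSyzygy_of_isRegularLocalRing d _ hd _))
    (b + 1 - min a (b + 1)).toNat (min a (b + 1)) b (by omega) X₀ hX₀
    (fun i z hz => hz.elim)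

/-- The radical is the intersection of the primes over the annihilator. A prime not containing I is
regular, so it misses some s annihilating `X` and does not contain the annihilator. -/
theorem le_radical_annihilator_end {I : Ideal R}
    (hSing : singularLocus R ⊆ PrimeSpectrum.zeroLocus (I : Set R)) (X : Dsg R) :
    I ≤ (Module.annihilator R (X ⟶ X)).radical := by
  rw [Ideal.radical_eq_sInf]
  refine le_sInf fun p ⟨hp, hpp⟩ => ?_
  by_contra hI
  obtain ⟨s, hs, h⟩ := locallyZero_of_isRegularLocalRing (p := p) (by
    by_contra h
    exact hI (hSing (show (⟨p, hpp⟩ : PrimeSpectrum R) ∈ singularLocus R from h))) X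
  refine hs (hp (Module.mem_annihilator.2 fun f => ?_))
  rw [← Category.id_comp f, ← Linear.smul_comp, h, zero_comp]

end LocallyZero

/-! ### Restriction along R → R/I on bounded derived categories -/

section DerivedFunctor

open DerivedCategory TStructure

variable {A B : Type*} [Category* A] [Abelian A] [HasDerivedCategory A] [Category* B] [Abelian B]
  [HasDerivedCategory B] (F : A ⥤ B) [F.Additive] [PreservesFiniteLimits F]
  [PreservesFiniteColimits F]

theorem isGE_mapDerivedCategory (X : DerivedCategory A) (n : ℤ) [X.IsGE n] :
    (F.mapDerivedCategory.obj X).IsGE n := by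
  obtain ⟨K, hK, ⟨e⟩⟩ := exists_iso_Q_obj_of_isGE X n
  let L : CochainComplex B ℤ := (F.mapHomologicalComplex (ComplexShape.up ℤ)).obj K
  have h : L.IsStrictlyGE n := by
    rw [CochainComplex.isStrictlyGE_iff]
    exact fun i hi => F.map_isZero (K.isZero_of_isStrictlyGE n i hi)
  let e' : F.mapDerivedCategory.obj X ≅ Q.obj L := F.mapDerivedCategory.mapIso e ≪≫
    F.mapDerivedCategoryFactors.app K
  exact t.isGE_of_iso e'.symm n

theorem isLE_mapDerivedCategory (X : DerivedCategory A) (n : ℤ) [X.IsLE n] :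
    (F.mapDerivedCategory.obj X).IsLE n := by
  obtain ⟨K, hK, ⟨e⟩⟩ := exists_iso_Q_obj_of_isLE X n
  let L : CochainComplex B ℤ := (F.mapHomologicalComplex (ComplexShape.up ℤ)).obj K
  have h : L.IsStrictlyLE n := by
    rw [CochainComplex.isStrictlyLE_iff]
    exact fun i hi => F.map_isZero (K.isZero_of_isStrictlyLE n i hi)
  let e' : F.mapDerivedCategory.obj X ≅ Q.obj L := F.mapDerivedCategory.mapIso e ≪≫
    F.mapDerivedCategoryFactors.app K
  exact t.isLE_of_iso e'.symm n

/-- The functor between bounded derived categories induced by an exact functor. -/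
abbrev mapBounded : DerivedCategory.Bounded A ⥤ DerivedCategory.Bounded B :=
  ObjectProperty.lift _ (t.bounded.ι ⋙ F.mapDerivedCategory) fun X => by
    obtain ⟨⟨a, ha⟩, ⟨b, hb⟩⟩ := X.property
    exact ⟨⟨a, isGE_mapDerivedCategory F X.obj a⟩, ⟨b, isLE_mapDerivedCategory F X.obj b⟩⟩

end DerivedFunctor

section RestrictQuotient

variable {R : Type u} [CommRing R] [IsNoetherianRing R] (I : Ideal R)

instance : (restrictQuotient I).Additive where
  map_add {_ _ _ _} := rfl

instance : PreservesFiniteLimits (restrictQuotient I) := by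
  have : PreservesFiniteLimits
      (restrictQuotient I ⋙ forget₂ (FGModuleCat.{u} R) (ModuleCat.{u} R)) :=
    inferInstanceAs (PreservesFiniteLimits
      (forget₂ (FGModuleCat.{u} (R ⧸ I)) (ModuleCat.{u} (R ⧸ I)) ⋙
        ModuleCat.restrictScalars (Ideal.Quotient.mk I)))
  exact preservesFiniteLimits_of_reflects_of_preserves (restrictQuotient I)
    (forget₂ (FGModuleCat.{u} R) (ModuleCat.{u} R))

instance : PreservesFiniteColimits (restrictQuotient I) := by
  have : PreservesFiniteColimits
      (restrictQuotient I ⋙ forget₂ (FGModuleCat.{u} R) (ModuleCat.{u} R)) :=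
    inferInstanceAs (PreservesFiniteColimits
      (forget₂ (FGModuleCat.{u} (R ⧸ I)) (ModuleCat.{u} (R ⧸ I)) ⋙
        ModuleCat.restrictScalars (Ideal.Quotient.mk I)))
  exact preservesFiniteColimits_of_reflects_of_preserves (restrictQuotient I)
    (forget₂ (FGModuleCat.{u} R) (ModuleCat.{u} R))

theorem radius_modQuotient_le : radius (modQuotient I) ≤ dimension (Db (R ⧸ I)) := by
  refine radius_le_dimension (mapBounded (restrictQuotient I) ⋙ (perfect R).trW.Q) _ ?_
  rintro Y ⟨N, ⟨e⟩⟩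
  refine ⟨(toDb (R ⧸ I)).obj N, ⟨?_ ≪≫ e⟩⟩
  exact (perfect R).trW.Q.mapIso (DerivedCategory.TStructure.t.bounded.isoMk
    (((restrictQuotient I).mapDerivedCategorySingleFunctor 0).app N))

theorem modQuotient_toDsg {N : FGModuleCat.{u} R} (h : IsKilled (I : Set R) N) :
    modQuotient I ((toDsg R).obj N) := by
  have ht : Module.IsTorsionBySet R N (I : Set R) := fun x a => by
    have := congrArg (fun f : N ⟶ N => f.hom.hom x) (h a.1 a.2)
    exact this
  let _ := ht.module
  have := Module.IsTorsionBySet.isScalarTower ht (S := R)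
  have hf : Module.Finite (R ⧸ I) N := Module.Finite.of_restrictScalars_finite R (R ⧸ I) N
  let e : N →ₗ[R]
      (ModuleCat.restrictScalars (Ideal.Quotient.mk I)).obj (ModuleCat.of (R ⧸ I) N) :=
    { toFun := fun x => x
      map_add' := fun _ _ => rfl
      map_smul' := fun _ _ => rfl }
  let e' : (ModuleCat.restrictScalars (Ideal.Quotient.mk I)).obj (ModuleCat.of (R ⧸ I) N) →ₗ[R] N :=
    { toFun := fun x => x
      map_add' := fun _ _ => rfl
      map_smul' := fun _ _ => rfl }
  let φ : N.obj ≅ (ModuleCat.restrictScalars (Ideal.Quotient.mk I)).obj (ModuleCat.of (R ⧸ I) N) :=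
    ⟨ModuleCat.ofHom e, ModuleCat.ofHom e', rfl, rfl⟩
  let ψ : N ≅ (restrictQuotient I).obj (FGModuleCat.of (R ⧸ I) N) :=
    ObjectProperty.isoMk _ φ
  exact ⟨FGModuleCat.of (R ⧸ I) N, ⟨(toDsg R).mapIso ψ.symm⟩⟩

end RestrictQuotient

/-! ### Sequences realizing grade and number of generators -/

section Grade

variable {R : Type u} [CommRing R] [IsNoetherianRing R] {I : Ideal R}

theorem exists_isWeaklyRegular_length_eq_grade (hI : I ≠ ⊤) :
    ∃ rs : List R, (∀ r ∈ rs, r ∈ I) ∧ RingTheory.Sequence.IsWeaklyRegular R rs ∧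
      rs.length = (grade I).toNat := by
  have h := (grade_le_spanFinrank I hI).trans_lt (ENat.natCast_lt_top _)
  have : Nonempty {rs : List R // (∀ r ∈ rs, r ∈ I) ∧ RingTheory.Sequence.IsWeaklyRegular R rs} :=
    ⟨[], by simp⟩
  rw [grade, iSup_subtype'] at h
  obtain ⟨⟨rs, h1, h2⟩, h3⟩ := ENat.exists_eq_iSup_of_lt_top h
  refine ⟨rs, h1, h2, ?_⟩
  rw [grade, iSup_subtype', ← h3, ENat.toNat_natCast]

theorem exists_list_span_eq (I : Ideal R) :
    ∃ zs : List R, Ideal.span {z | z ∈ zs} = I ∧ zs.length = I.spanFinrank := by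
  obtain ⟨s, hs, h⟩ := (IsNoetherian.noetherian I).exists_span_finset_card_eq_spanFinrank
  exact ⟨s.toList, by simpa using h, by simpa using hs⟩

end Grade

/-! ### The two equalities for `D_sg(R)` -/

section Main

variable {R : Type u} [CommRing R] [IsNoetherianRing R] {I : Ideal R}

theorem ball_filtPrimes_eq_top (hI : I ≠ ⊤)
    (hSing : singularLocus R ⊆ PrimeSpectrum.zeroLocus (I : Set R)) :
    ball (filtPrimes I) (ballRadius I) = ⊤ := by
  obtain ⟨rs, hrs, hreg, hlen⟩ := exists_isWeaklyRegular_length_eq_grade hI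
  obtain ⟨xs, hspan, hxs⟩ := exists_list_span_eq I
  refine eq_top_iff.2 fun X _ => ?_
  have hx : ∀ x ∈ xs, ∃ k : ℕ, x ^ k • 𝟙 X = 0 := fun x hx => by
    have hxI : x ∈ I := hspan ▸ Ideal.subset_span (α := R) hx
    obtain ⟨k, hk⟩ := le_radical_annihilator_end hSing X hxI
    exact ⟨k, Module.mem_annihilator.1 hk _⟩
  choose! k hk using hx
  -- Passing to powers changes neither the number of elements nor the radical, so the regular
  -- sequence in I still lies in the radical of their span.
  let zs := xs.map fun x => x ^ k x
  have hrad : I ≤ (Ideal.span {z | z ∈ zs}).radical := by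
    conv_lhs => rw [← hspan]
    exact Ideal.span_le.2 fun x hx => ⟨k x, Ideal.subset_span (List.mem_map_of_mem (f := fun x => x ^ k x) hx)⟩
  have hle : rs.length ≤ zs.length := by
    rw [List.length_map, hxs, hlen]
    exact ENat.toNat_le_of_le_natCast (grade_le_spanFinrank I hI)
  have h := ball_of_isKilled zs rs hreg (fun y hy => hrad (hrs y hy)) hle (filtPrimes I)
    (fun N hN => ?_) X fun z hz => ?_
  · rwa [List.length_map, hxs, hlen] at h
  · rcases filt_cyclicPrimes_of_smul_eq_zero (I := I) N fun x hx => by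
      obtain ⟨m, hm⟩ := hN.exists_pow_smul_eq_zero (hrad hx) (𝟙 N)
      exact ⟨m, fun a => congrArg (fun f : N ⟶ N => f.hom.hom a) hm⟩ with h0 | h0
    · have : IsZero N := by
        rw [IsZero.iff_id_eq_zero]
        ext a
        exact Subsingleton.elim _ _
      exact (isAddShiftClosed_bracket _).of_isZero ((toDsg R).map_isZero this)
    · exact le_bracket _ _ (ObjectProperty.prop_map_obj _ (toDsg R) h0)
  · obtain ⟨x, hx, rfl⟩ := List.mem_map.1 hz
    exact hk x hx

theorem ball_modQuotient_eq_top (hI : I ≠ ⊤) (hann : I ≤ annDsg R) :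
    ball (modQuotient I) (ballRadius I) = ⊤ := by
  obtain ⟨rs, hrs, hreg, hlen⟩ := exists_isWeaklyRegular_length_eq_grade hI
  obtain ⟨xs, hspan, hxs⟩ := exists_list_span_eq I
  refine eq_top_iff.2 fun X _ => ?_
  have hle : rs.length ≤ xs.length := by
    rw [hxs, hlen]
    exact ENat.toNat_le_of_le_natCast (grade_le_spanFinrank I hI)
  have h := ball_of_isKilled xs rs hreg (fun y hy => Ideal.le_radical (hspan.symm ▸ hrs y hy)) hle
    (modQuotient I) (fun N hN => le_bracket _ _ (modQuotient_toDsg I (hspan ▸ hN.span))) X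
    fun z hz => Module.mem_annihilator.1
      ((Submodule.mem_iInf _).1 (hann (hspan ▸ Ideal.subset_span hz)) X) _
  rwa [hxs, hlen] at h

end Main

end SgCat

end

theorem mainTheorem2 (R : Type u) [CommRing R] [IsNoetherianRing R] (I : Ideal R) (hI : I ≠ ⊤)
    (hSing : SgCat.singularLocus R ⊆ PrimeSpectrum.zeroLocus (I : Set R)) :
    SgCat.ball (SgCat.filtPrimes I) (SgCat.ballRadius I) = ⊤ ∧
    (I ≤ SgCat.annDsg R →
      SgCat.ball (SgCat.modQuotient I) (SgCat.ballRadius I) = ⊤ ∧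
      SgCat.dimension (SgCat.Dsg R) ≤
        (SgCat.radius (SgCat.modQuotient I) + 1) * SgCat.ballRadius I - 1 ∧
      (SgCat.radius (SgCat.modQuotient I) + 1) * SgCat.ballRadius I - 1 ≤
        (SgCat.dimension (SgCat.Db (R ⧸ I)) + 1) * SgCat.ballRadius I - 1) := by
  refine ⟨SgCat.ball_filtPrimes_eq_top hI hSing, fun hann => ?_⟩
  have h := SgCat.ball_modQuotient_eq_top hI hann
  refine ⟨h, SgCat.dimension_le_of_ball_eq_top (Nat.succ_pos _) h, ?_⟩
  gcongr
  exact SgCat.radius_modQuotient_le I
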